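/- Let $A$ be a Dedekind domain such that for every nonzero prime ideal $\mathfrak p$ of $A$ the local ring $A_{\mathfrak p}$ has mixed characteristic (that is, $A_{\mathfrak p}$ has characteristic zero and its residue field has positive characteristic) and finite residue field. Let $R=A[X_1,\dots,X_n]$ be $\mathbb Z^n$-graded by $\deg a=0$ for $a\in A$ and $\deg X_j=e_j$, and let $I=(a_1U_1,\dots,a_cU_c)\subseteq R$ with $a_j\in A$ (not necessarily units) and $U_j$ monomials in $X_1,\dots,X_n$ (a $\mathfrak C$-monomial ideal). Let $i\ge 0$ and let $M=H^i_I(R)=\bigoplus_{u\in\mathbb Z^n}M_u$ be the local cohomology module with its natural $\mathbb Z^n$-grading, i.e. the $i$-th cohomology of the Čech complex of $R$ on the homogeneous elements $a_1U_1,\dots,a_cU_c$. For an ideal $J$ of a commutative ring $B$ and a $B$-module $L$ put $\Gamma_J(L)=\bigcup_{m\ge 1}(0:_L J^m)$. Fix $u\in\mathbb Z^n$. (1) For every nonzero $\mathfrak p\in\operatorname{Ass}_A M$ there are integers $\ell,t\ge 0$ and $\beta_1,\dots,\beta_t\ge 0$ (depending on $\mathfrak p$ and $u$) and an isomorphism of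 $A$-modules $$\Gamma_{\mathfrak p}(M_u)\;\cong\;E_A(A/\mathfrak p)^{\ell}\oplus\bigoplus_{j=1}^{t}A/\mathfrak p^{\beta_j},$$ where $E_A(A/\mathfrak p)$ is the injective hull of $A/\mathfrak p$ over $A$. (2) Let $\mathfrak q$ be a nonzero prime ideal of $A$, let $T=\widehat{A_{\mathfrak q}}$ be the completion of $A_{\mathfrak q}$ with respect to its maximal ideal, let $K_{\mathfrak q}$ be the fraction field of $T$, let $S=T[X_1,\dots,X_n]$, and let $N=M\otimes_A T$, with $N_u=M_u\otimes_A T$. Then $N_u\cong H^i_{IS}(S)_u$ as $T$-modules, and there are integers $a,b\ge 0$ (depending on $\mathfrak q$ and $u$) and an isomorphism of $T$-modules $$N_u/\Gamma_{\mathfrak q T}(N_u)\;\cong\;T^{a}\oplus K_{\mathfrak q}^{b}.$$ -/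

import Mathlib

open scoped TensorProduct

/-! ### Torsion with respect to an ideal -/

/-- `Γ_J(N) = ⋃ₘ (0 :_N Jᵐ)`, the `J`-torsion submodule of `N`. -/
def gammaTorsion {A : Type*} [CommRing A] (J : Ideal A) (N : Type*) [AddCommGroup N]
    [Module A N] : Submodule A N where
  carrier := {x | ∃ m : ℕ, ∀ r ∈ J ^ m, r • x = 0}
  zero_mem' := ⟨0, fun r _ => smul_zero r⟩
  add_mem' := by
    rintro x y ⟨m, hm⟩ ⟨k, hk⟩
    refine ⟨m + k, fun r hr => ?_⟩
    rw [smul_add, hm r (Ideal.pow_le_pow_right (Nat.le_add_right m k) hr),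
      hk r (Ideal.pow_le_pow_right (Nat.le_add_left k m) hr), add_zero]
  smul_mem' := by
    rintro c x ⟨m, hm⟩
    exact ⟨m, fun r hr => by rw [smul_comm, hm r hr, smul_zero]⟩

/-! ### Injective hulls -/

/-- `ι : N → E` is an injective hull of `N`: `E` is an injective module, `ι` is injective, and
every nonzero submodule of `E` meets the image of `ι` nontrivially. -/
structure IsInjectiveHull {A : Type*} [CommRing A] {N : Type*} [AddCommGroup N] [Module A N]
    {E : Type*} [AddCommGroup E] [Module A E] (ι : N →ₗ[A] E) : Prop where
  moduleInjective : Module.Injective A E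
  injective : Function.Injective ι
  essential : ∀ W : Submodule A E, W ⊓ LinearMap.range ι = ⊥ → W = ⊥

/-- Every module has an injective hull. -/
theorem exists_isInjectiveHull.{u} (A : Type u) [CommRing A] (N : Type u) [AddCommGroup N]
    [Module A N] :
    ∃ (E : ModuleCat.{u} A) (ι : N →ₗ[A] E), IsInjectiveHull ι := by
  have : CategoryTheory.EnoughInjectives (ModuleCat.{u} A) := inferInstance
  obtain ⟨⟨J, hJ, f, hf⟩⟩ := this.presentation (ModuleCat.of A N)
  have hQ : Module.Injective A J := (Module.injective_iff_injective_object A J).2 hJ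
  have hfi : Function.Injective f.hom := (ModuleCat.mono_iff_injective f).1 hf
  -- `E` is a maximal essential extension of the image of `N` in an injective module `J`.
  obtain ⟨E, hNE, ⟨-, hE⟩, hmax⟩ := zorn_le_nonempty₀
    {W : Submodule A J | LinearMap.range f.hom ≤ W ∧
      ∀ V ≤ W, V ⊓ LinearMap.range f.hom = ⊥ → V = ⊥}
    (by
      intro K hK hchain y hy
      refine ⟨sSup K, ⟨(hK hy).1.trans (le_sSup hy), fun V hV hVN => ?_⟩, fun z => le_sSup⟩
      rw [eq_bot_iff]
      intro x hx
      obtain ⟨W, hW, hxW⟩ :=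
        (Submodule.mem_sSup_of_directed ⟨y, hy⟩ hchain.directedOn).1 (hV hx)
      have h0 : V ⊓ W = ⊥ := (hK hW).2 _ inf_le_right
        (eq_bot_iff.2 ((inf_le_inf_right _ inf_le_left).trans hVN.le))
      exact h0.le ⟨hx, hxW⟩)
    (LinearMap.range f.hom)
    ⟨le_rfl, fun V hV h => by rwa [inf_eq_left.2 hV] at h⟩
  obtain ⟨C, -, hC, hCmax⟩ := zorn_le_nonempty₀ {W : Submodule A J | W ⊓ E = ⊥}
    (by
      intro K hK hchain y hy
      refine ⟨sSup K, ?_, fun z => le_sSup⟩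
      rw [Set.mem_ofPred_eq, eq_bot_iff]
      rintro x ⟨hx, hxE⟩
      obtain ⟨W, hW, hxW⟩ := (Submodule.mem_sSup_of_directed ⟨y, hy⟩ hchain.directedOn).1 hx
      exact (show W ⊓ E = ⊥ from hK hW).le ⟨hxW, hxE⟩)
    ⊥ (by simp)
  have hC0 : C ⊓ E = ⊥ := hC
  have hginj : Function.Injective (C.mkQ ∘ₗ E.subtype) := by
    rw [← LinearMap.ker_eq_bot, eq_bot_iff]
    intro x hx
    have hxC : (x : J) ∈ C := by simpa using hx
    exact Subtype.ext (hC0.le ⟨hxC, x.2⟩)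
  obtain ⟨h, hh⟩ := hQ.out (C.mkQ ∘ₗ E.subtype) hginj E.subtype
  have hh' : ∀ x ∈ E, h (C.mkQ x) = x := fun x hx => hh ⟨x, hx⟩
  have hkey : ∀ V : Submodule A J, V ⊓ E = ⊥ → ∀ y, h y ∈ V → y = 0 := by
    intro V hV y hy
    obtain ⟨x, rfl⟩ := C.mkQ_surjective y
    have hle : C ≤ (V.comap h).comap C.mkQ := fun z hz => by
      have : C.mkQ z = 0 := by simpa using hz
      simp [Submodule.mem_comap, this]
    have hD : (V.comap h).comap C.mkQ ∈ {W : Submodule A J | W ⊓ E = ⊥} := by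
      rw [Set.mem_ofPred_eq, eq_bot_iff]
      rintro z ⟨hz, hzE⟩
      have hz' : h (C.mkQ z) ∈ V := hz
      rw [hh' z hzE] at hz'
      exact hV.le ⟨hz', hzE⟩
    have hx : x ∈ C := hCmax hD hle hy
    simpa using hx
  have hrange : LinearMap.range h ≤ E := by
    have hEr : E ≤ LinearMap.range h := fun x hx => ⟨_, hh' x hx⟩
    refine hmax ⟨hNE.trans hEr, fun V hV hVN => ?_⟩ hEr
    have hVE : V ⊓ E = ⊥ := hE _ inf_le_right
      (eq_bot_iff.2 ((inf_le_inf_right _ inf_le_left).trans hVN.le))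
    rw [eq_bot_iff]
    intro x hx
    obtain ⟨y, rfl⟩ := hV hx
    simp [hkey V hVE y hx]
  let r : J →ₗ[A] E := (h ∘ₗ C.mkQ).codRestrict E fun x => hrange ⟨_, rfl⟩
  refine ⟨ModuleCat.of A E, f.hom.codRestrict E fun x => hNE ⟨x, rfl⟩, ⟨?_, ?_, ?_⟩⟩
  · refine ⟨fun X Y _ _ _ _ k hk g => ?_⟩
    obtain ⟨g', hg'⟩ := hQ.out k hk (E.subtype ∘ₗ g)
    refine ⟨r ∘ₗ g', fun x => Subtype.ext ?_⟩
    change h (C.mkQ (g' (k x))) = _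
    rw [hg' x]
    exact hh' _ (g x).2
  · intro x y hxy
    exact hfi (congrArg Subtype.val hxy)
  · intro W hW
    have h0 : W.map E.subtype = ⊥ := by
      refine hE _ (Submodule.map_subtype_le _ _) (eq_bot_iff.2 ?_)
      rintro _ ⟨⟨x, hx, rfl⟩, ⟨y, hy⟩⟩
      have : x = 0 := hW.le ⟨hx, ⟨y, Subtype.ext hy⟩⟩
      simp [this]
    rw [eq_bot_iff]
    intro x hx
    have hx0 : (x : J) ∈ W.map E.subtype := ⟨x, hx, rfl⟩
    rw [h0] at hx0
    exact Subtype.ext hx0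

/-- The injective hull `E_A(N)` of an `A`-module `N` (unique up to isomorphism). -/
noncomputable def InjectiveHull.{u} (A : Type u) [CommRing A] (N : Type u) [AddCommGroup N]
    [Module A N] : ModuleCat.{u} A :=
  (exists_isInjectiveHull A N).choose

/-! ### Local cohomology of a ring, as the cohomology of the Čech complex -/

section Cech

variable {R : Type*} [CommRing R] {c : ℕ}

/-- The localization map `R_x → R_y` when `x` divides `y`. -/
noncomputable def awayMap {x y : R} (h : x ∣ y) :
    Localization.Away x →ₐ[R] Localization.Away y :=
  IsLocalization.liftAlgHom (M := Submonoid.powers x)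
    (f := Algebra.ofId R (Localization.Away y)) (by
      rintro ⟨_, m, rfl⟩
      have hy : IsUnit (algebraMap R (Localization.Away y) y) :=
        IsLocalization.Away.algebraMap_isUnit y
      simpa [Algebra.ofId_apply] using
        (isUnit_of_dvd_unit (map_dvd (algebraMap R (Localization.Away y)) h) hy).pow m)

/-- `Čᵏ(f; R) = ⨁_{|S| = k} R_{f_S}` with `f_S = ∏_{j ∈ S} f_j`. -/
abbrev CechCochain (f : Fin c → R) (k : ℕ) : Type _ :=
  ∀ S : {S : Finset (Fin c) // S.card = k}, Localization.Away (∏ j ∈ S.1, f j)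

/-- The Čech differential: if `S = {j₀ < ⋯ < j_k}`, then `(dx)_S = ∑ₛ (-1)ˢ x_{S ∖ {jₛ}}`,
the terms being mapped to `R_{f_S}`. -/
noncomputable def cechD (f : Fin c → R) (k : ℕ) :
    CechCochain f k →ₗ[R] CechCochain f (k + 1) :=
  LinearMap.pi fun S => ∑ j : S.1,
    (-1 : R) ^ (S.1.filter (· < j.1)).card •
      ((awayMap (Finset.prod_dvd_prod_of_subset _ _ f (Finset.erase_subset j.1 S.1))).toLinearMap
        ∘ₗ LinearMap.proj
          (⟨S.1.erase j.1, by rw [Finset.card_erase_of_mem j.2, S.2]; rfl⟩ :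
            {S : Finset (Fin c) // S.card = k}))

/-- The cocycles of the Čech complex. -/
noncomputable abbrev cechCocycles (f : Fin c → R) (i : ℕ) : Submodule R (CechCochain f i) :=
  LinearMap.ker (cechD f i)

/-- The coboundaries of the Čech complex. -/
noncomputable def cechCoboundaries (f : Fin c → R) :
    (i : ℕ) → Submodule R (CechCochain f i)
  | 0 => ⊥
  | i + 1 => LinearMap.range (cechD f i)

/-- The local cohomology module `H^i_I(R)` for `I = (f₁, …, f_c)`: the `i`-th cohomology of the
Čech complex `0 → R → ⨁ R_{f_j} → ⨁ R_{f_j f_k} → ⋯ → R_{f₁⋯f_c} → 0`. -/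
abbrev LocalCohomologyModule (f : Fin c → R) (i : ℕ) : Type _ :=
  cechCocycles f i ⧸ (cechCoboundaries f i).submoduleOf (cechCocycles f i)

end Cech

/-! ### The multigrading for `ℭ`-monomial ideals -/

section Grading

variable {A : Type*} [CommRing A] {n c : ℕ}

/-- The generators `a_j X^{ξ_j}` of a `ℭ`-monomial ideal in `A[X₁, …, X_n]`. -/
noncomputable abbrev cMonomial (a : Fin c → A) (ξ : Fin c → Fin n →₀ ℕ) :
    Fin c → MvPolynomial (Fin n) A :=
  fun j => MvPolynomial.monomial (ξ j) (a j)

/-- For `f ∈ A[X₁, …, X_n]` homogeneous of multidegree `e`, the degree `u` component of the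
localization `A[X₁, …, X_n]_f`: it is spanned by the fractions `b X^d / f^m` with `d - m e = u`. -/
noncomputable def awayDegree (f : MvPolynomial (Fin n) A) (e : Fin n →₀ ℕ) (u : Fin n → ℤ) :
    Submodule A (Localization.Away f) :=
  Submodule.span A {x | ∃ (m : ℕ) (d : Fin n →₀ ℕ) (b : A),
    (∀ k, (d k : ℤ) - m * e k = u k) ∧
      x * algebraMap (MvPolynomial (Fin n) A) (Localization.Away f) (f ^ m) =
        algebraMap (MvPolynomial (Fin n) A) (Localization.Away f) (MvPolynomial.monomial d b)}

/-- The degree `u` component of the Čech complex on the generators `a_j X^{ξ_j}`. -/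
noncomputable def cechDegree (a : Fin c → A) (ξ : Fin c → Fin n →₀ ℕ) (k : ℕ) (u : Fin n → ℤ) :
    Submodule A (CechCochain (cMonomial a ξ) k) :=
  Submodule.pi Set.univ fun S => awayDegree (∏ j ∈ S.1, cMonomial a ξ j) (∑ j ∈ S.1, ξ j) u

/-- The degree `u` component of `H^i_I(A[X₁, …, X_n])`, where `I` is generated by the
`a_j X^{ξ_j}`: the classes of the cocycles of degree `u`. -/
noncomputable def localCohomologyDegree (a : Fin c → A) (ξ : Fin c → Fin n →₀ ℕ) (i : ℕ)
    (u : Fin n → ℤ) : Submodule A (LocalCohomologyModule (cMonomial a ξ) i) :=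
  ((cechDegree a ξ i u).comap ((cechCocycles (cMonomial a ξ) i).subtype.restrictScalars A)).map
    (((cechCoboundaries (cMonomial a ξ) i).submoduleOf
      (cechCocycles (cMonomial a ξ) i)).mkQ.restrictScalars A)

end Grading

/-! ### Rings -/

/-- A local ring has mixed characteristic: it has characteristic zero and its residue field has
positive characteristic. -/
def IsMixedChar (B : Type*) [CommRing B] [IsLocalRing B] : Prop :=
  CharZero B ∧ ringChar (IsLocalRing.ResidueField B) ≠ 0

/-- The completion of the local ring `A_𝔮` with respect to its maximal ideal. -/
abbrev CompletedLocalization {A : Type*} [CommRing A] (q : Ideal A) [q.IsPrime] : Type _ :=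
  AdicCompletion (IsLocalRing.maximalIdeal (Localization.AtPrime q)) (Localization.AtPrime q)

/-! Taking the coefficient of `X^u` identifies the degree `u` part of `A[X]` localized at a term `α
X^e` with `A_α` if `u k ≥ 0` wherever `e k = 0`, and with `0` otherwise. Hence `M_u` is the
cohomology of the part of the Čech complex of `A` on `a_1, …, a_c` supported on an explicit family
of index sets (`nonempty_localCohomologyDegree_equiv`). The variables have disappeared, and since
the modules `A_α` are compatible with base change, so is `M_u` when the base change is flat
(`nonempty_localCohomologyDegree_baseChange_equiv`).

Over a discrete valuation ring `B` with fraction field `K`, each `B_α` is `0`, `B` or `K`. The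
cocycles coming from the summands `K` map onto a submodule `D` of the cohomology whose cokernel is
finitely generated; modulo a `K`-subspace, the relations defining `D` are finitely generated too. So
`D` is a sum of copies of `K/B` and `K`. It is divisible, hence injective over a principal ideal
domain, and splits off. The cohomology is therefore `(K/B)^l ⊕ K^s` plus a finitely generated module
(`LinearHomology.exists_equiv`), from which the torsion and the torsion-free quotient can be read
off.

For (1) take `B = A_p`: localizing at `p` does not change the `p`-torsion, and `K/A_p` is the
injective hull of `A/p` (`nonempty_fractionQuotient_equiv_injectiveHull`). For (2) take `B` to be
the completion of `A_q`, which is again a discrete valuation ring and is flat over `A`. -/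

/-! ### Homology of two linear maps and flat base change -/

section Homology

/-- Two surjective linear maps with the same kernel have isomorphic targets. -/
theorem LinearMap.nonempty_equiv_of_surjective_of_ker_eq {R M P Q : Type*} [CommRing R]
    [AddCommGroup M] [Module R M] [AddCommGroup P] [Module R P] [AddCommGroup Q] [Module R Q]
    (f : M →ₗ[R] P) (g : M →ₗ[R] Q) (hf : Function.Surjective f) (hg : Function.Surjective g)
    (h : LinearMap.ker f = LinearMap.ker g) : Nonempty (P ≃ₗ[R] Q) :=
  ⟨(f.quotKerEquivOfSurjective hf).symm ≪≫ₗ Submodule.quotEquivOfEq _ _ h ≪≫ₗ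
    g.quotKerEquivOfSurjective hg⟩

/-- The homology `ker g / im f` of `X → Y → Z`. -/
abbrev LinearHomology {R X Y Z : Type*} [CommRing R] [AddCommGroup X] [Module R X]
    [AddCommGroup Y] [Module R Y] [AddCommGroup Z] [Module R Z]
    (f : X →ₗ[R] Y) (g : Y →ₗ[R] Z) : Type _ :=
  LinearMap.ker g ⧸ (LinearMap.range f).submoduleOf (LinearMap.ker g)

/-- Homology commutes with flat base change. -/
theorem LinearHomology.nonempty_baseChange_equiv {R S X Y Z X' Y' Z' : Type*} [CommRing R]
    [CommRing S] [Algebra R S] [Module.Flat R S]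
    [AddCommGroup X] [Module R X] [AddCommGroup Y] [Module R Y] [AddCommGroup Z] [Module R Z]
    [AddCommGroup X'] [Module R X'] [Module S X'] [IsScalarTower R S X']
    [AddCommGroup Y'] [Module R Y'] [Module S Y'] [IsScalarTower R S Y']
    [AddCommGroup Z'] [Module R Z'] [Module S Z'] [IsScalarTower R S Z']
    {f : X →ₗ[R] Y} {g : Y →ₗ[R] Z}
    {f' : X' →ₗ[S] Y'} {g' : Y' →ₗ[S] Z'}
    {tX : X →ₗ[R] X'} {tY : Y →ₗ[R] Y'} {tZ : Z →ₗ[R] Z'}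
    (hX : IsBaseChange S tX) (hY : IsBaseChange S tY) (hZ : IsBaseChange S tZ)
    (hf : ∀ x, f' (tX x) = tY (f x)) (hg : ∀ y, g' (tY y) = tZ (g y)) :
    Nonempty ((S ⊗[R] LinearHomology f g) ≃ₗ[S] LinearHomology f' g') := by
  have hf' : ∀ x, f' (hX.equiv x) = hY.equiv (f.lTensor S x) := fun x => by
    induction x with
    | zero => simp
    | tmul s x => simp [IsBaseChange.equiv_tmul, hf]
    | add x y hx hy => simp only [map_add, hx, hy]
  have hg' : ∀ y, g' (hY.equiv y) = hZ.equiv (g.lTensor S y) := fun x => by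
    induction x with
    | zero => simp
    | tmul s x => simp [IsBaseChange.equiv_tmul, hg]
    | add x y hx hy => simp only [map_add, hx, hy]
  let i : S ⊗[R] LinearMap.ker g →ₗ[S] S ⊗[R] Y :=
    (LinearMap.ker g).subtype.baseChange S
  have hi : Function.Injective i :=
    Module.Flat.lTensor_preserves_injective_linearMap _ (LinearMap.ker g).injective_subtype
  have hex : Function.Exact i (g.lTensor S) :=
    Module.Flat.lTensor_exact S (f := (LinearMap.ker g).subtype) (g := g)
      (LinearMap.exact_subtype_ker_map g)
  let θ : S ⊗[R] LinearMap.ker g →ₗ[S] LinearMap.ker g' :=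
    (hY.equiv.toLinearMap ∘ₗ i).codRestrict _ fun x => by
      change g' (hY.equiv (i x)) = 0
      rw [hg', (hex (i x)).2 ⟨x, rfl⟩, map_zero]
  have hθ : ∀ x, (θ x : Y') = hY.equiv (i x) := fun x => rfl
  have hθs : Function.Surjective θ := by
    rintro ⟨y, hy⟩
    obtain ⟨w, rfl⟩ := hY.equiv.surjective y
    have hw : g.lTensor S w = 0 := hZ.equiv.injective (by
      rw [← hg', map_zero]; exact hy)
    obtain ⟨x, rfl⟩ := (hex w).1 hw
    exact ⟨x, rfl⟩
  let K := (LinearMap.range f).submoduleOf (LinearMap.ker g)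
  -- The composite `g ∘ f` is not assumed to vanish: `submoduleOf` intersects the image of `f` with
  -- `ker g`, so the relations are parametrized by `ker (g ∘ f)`, which flatness also preserves.
  let f₁ : LinearMap.ker (g ∘ₗ f) →ₗ[R] LinearMap.ker g :=
    (f ∘ₗ (LinearMap.ker (g ∘ₗ f)).subtype).codRestrict _ fun x => x.2
  have hexq : Function.Exact f₁ K.mkQ := by
    intro y
    rw [Submodule.mkQ_apply, Submodule.Quotient.mk_eq_zero]
    constructor
    · rintro ⟨x, hx⟩
      exact ⟨⟨x, LinearMap.mem_ker.2 (by rw [LinearMap.comp_apply, hx]; exact y.2)⟩, Subtype.ext hx⟩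
    · rintro ⟨x, rfl⟩
      exact ⟨x, rfl⟩
  have hex2 := lTensor_exact S hexq K.mkQ_surjective
  let j : LinearMap.ker (g ∘ₗ f) →ₗ[R] X := (LinearMap.ker (g ∘ₗ f)).subtype
  have hj : Function.Exact (j.lTensor S) ((g ∘ₗ f).lTensor S) :=
    Module.Flat.lTensor_exact S (LinearMap.exact_subtype_ker_map (g ∘ₗ f))
  have hi2 : ∀ x, i (f₁.lTensor S x) = f.lTensor S (j.lTensor S x) := fun x => by
    change (LinearMap.ker g).subtype.lTensor S (f₁.lTensor S x) = _
    rw [← LinearMap.lTensor_comp_apply, ← LinearMap.lTensor_comp_apply]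
    rfl
  -- Both sides are quotients of `S ⊗ ker g`, so it suffices to compare the two kernels.
  refine LinearMap.nonempty_equiv_of_surjective_of_ker_eq (K.mkQ.baseChange S)
    (((LinearMap.range f').submoduleOf (LinearMap.ker g')).mkQ ∘ₗ θ) ?_
    ((Submodule.mkQ_surjective _).comp hθs) ?_
  · exact LinearMap.lTensor_surjective S K.mkQ_surjective
  · ext t
    rw [LinearMap.mem_ker, LinearMap.mem_ker, LinearMap.comp_apply, Submodule.mkQ_apply,
      Submodule.Quotient.mk_eq_zero]
    change (K.mkQ.lTensor S) t = 0 ↔ _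
    rw [hex2 t]
    constructor
    · rintro ⟨x, rfl⟩
      refine ⟨hX.equiv (j.lTensor S x), ?_⟩
      rw [hf']
      change _ = (θ _ : Y')
      rw [hθ, hi2]
    · rintro ⟨x, hx⟩
      obtain ⟨x, rfl⟩ := hX.equiv.surjective x
      have hx0 : (g ∘ₗ f).lTensor S x = 0 := by
        apply hZ.equiv.injective
        rw [LinearMap.lTensor_comp_apply, ← hg', ← hf', hx, map_zero]
        exact (θ t).2
      obtain ⟨x, rfl⟩ := (hj x).1 hx0
      refine ⟨x, hi (hY.equiv.injective ?_)⟩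
      rw [hi2, ← hf', hx]
      rfl

end Homology

/-! ### Homology of modules mixed from a discrete valuation ring and its fraction field -/

section DiscreteValuationRing

/-- Over a principal ideal domain, divisible modules satisfy Baer's criterion. -/
theorem Module.Baer.of_forall_exists_smul_eq {B Q : Type*} [CommRing B] [IsDomain B]
    [IsPrincipalIdealRing B] [AddCommGroup Q] [Module B Q]
    (h : ∀ b : B, b ≠ 0 → ∀ x : Q, ∃ y, b • y = x) : Module.Baer B Q := by
  intro I g
  obtain ⟨b, rfl⟩ := IsPrincipalIdealRing.principal I
  by_cases hb : b = 0
  · subst hb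
    refine ⟨0, fun x hx => ?_⟩
    have hx0 : x = 0 := by simpa using hx
    subst hx0
    rw [map_zero]
    exact (map_zero g).symm
  · obtain ⟨y, hy⟩ := h b hb (g ⟨b, Submodule.mem_span_singleton_self b⟩)
    refine ⟨LinearMap.toSpanSingleton B Q y, fun x hx => ?_⟩
    obtain ⟨c, rfl⟩ := Submodule.mem_span_singleton.1 hx
    rw [LinearMap.toSpanSingleton_apply, smul_assoc, hy, ← map_smul]
    rfl

/-- The range of `β` is finitely generated if `β` factors through a submodule of a Noetherian
module. -/
theorem LinearMap.fg_range_of_ker_le {B R F Q : Type*} [CommRing B] [AddCommGroup R] [Module B R]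
    [AddCommGroup F] [Module B F] [IsNoetherian B F] [AddCommGroup Q] [Module B Q]
    (α : R →ₗ[B] F) (β : R →ₗ[B] Q) (h : LinearMap.ker α ≤ LinearMap.ker β) :
    (LinearMap.range β).FG := by
  have : Module.Finite B (R ⧸ LinearMap.ker α) := Module.Finite.equiv α.quotKerEquivRange.symm
  rw [← Submodule.range_liftQ (LinearMap.ker α) β h]
  exact Module.Finite.iff_fg.1 inferInstance

variable {B K : Type*} [CommRing B] [Field K] [Algebra B K]

/-- The module `K / B`. -/
abbrev FractionQuotient (B K : Type*) [CommRing B] [Field K] [Algebra B K] : Type _ :=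
  K ⧸ LinearMap.range (Algebra.linearMap B K)

/-- Division by `b` takes place on a lift to `K`. This divisibility makes `K / B` injective over a
principal ideal domain. -/
theorem FractionQuotient.exists_smul_eq [IsDomain B] [IsFractionRing B K] (b : B) (hb : b ≠ 0)
    (x : FractionQuotient B K) : ∃ y, b • y = x := by
  obtain ⟨x, rfl⟩ := Submodule.mkQ_surjective _ x
  refine ⟨Submodule.mkQ _ ((algebraMap B K b)⁻¹ * x), ?_⟩
  rw [← map_smul, Algebra.smul_def, ← mul_assoc, mul_inv_cancel₀, one_mul]
  simpa using hb

/-- A finite linearly independent family extends to a finite basis. -/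
theorem LinearIndependent.exists_finite_basis_sum {V : Type*} [AddCommGroup V] [Module K V]
    [Module.Finite K V] {ι : Type*} {v : ι → V} (hv : LinearIndependent K v) :
    ∃ (m : ℕ) (w : Module.Basis (ι ⊕ Fin m) K V), ∀ i, w (Sum.inl i) = v i := by
  let w := Module.Basis.sumExtend hv
  have : Finite (ι ⊕ Module.Basis.sumExtendIndex hv) := Module.Finite.finite_basis w
  have : Finite (Module.Basis.sumExtendIndex hv) := Finite.of_injective _ (Sum.inr_injective (α := ι))
  have := Fintype.ofFinite (Module.Basis.sumExtendIndex hv)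
  refine ⟨_, w.reindex ((Equiv.refl ι).sumCongr (Fintype.equivFin _)), fun i => ?_⟩
  rw [Module.Basis.reindex_apply]
  simp [w, Module.Basis.sumExtend]
  rfl

/-- A quotient of a finite-dimensional `K`-space by a finitely generated `B`-submodule. -/
theorem exists_equiv_of_surjective_of_fg_ker [IsDomain B] [IsPrincipalIdealRing B]
    [IsFractionRing B K] {V D : Type*}
    [AddCommGroup V] [Module K V] [Module B V] [IsScalarTower B K V] [Module.Finite K V]
    [AddCommGroup D] [Module B D] (φ : V →ₗ[B] D) (hφ : Function.Surjective φ)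
    (hfg : (LinearMap.ker φ).FG) :
    ∃ l s : ℕ, Nonempty (D ≃ₗ[B] (Fin l → FractionQuotient B K) × (Fin s → K)) := by
  have : Module.Finite B (LinearMap.ker φ) := Module.Finite.iff_fg.2 hfg
  have : Module.IsTorsionFree B K := inferInstance
  have : Module.IsTorsionFree B V := Module.IsTorsionFree.trans K
  -- The kernel is free, being finitely generated and torsion-free. Its basis stays independent over
  -- `K` and extends to a `K`-basis of `V`; in these coordinates the kernel is `B^l × 0`, so the
  -- quotient is `(K/B)^l × K^m`.
  obtain ⟨l, b⟩ := Module.basisOfFiniteTypeTorsionFree' (R := B) (M := LinearMap.ker φ)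
  have hli : LinearIndependent K (fun i => (b i : V)) :=
    (LinearIndependent.iff_fractionRing B K).1
      (b.linearIndependent.map' _ (LinearMap.ker_eq_bot.2 (LinearMap.ker φ).injective_subtype))
  obtain ⟨m, w, hw⟩ := hli.exists_finite_basis_sum
  classical
  let q := (LinearMap.range (Algebra.linearMap B K)).mkQ
  have hq : ∀ x : K, q x = 0 ↔ ∃ c : B, algebraMap B K c = x := fun x =>
    Submodule.Quotient.mk_eq_zero _
  let ψ : V →ₗ[B] (Fin l → FractionQuotient B K) × (Fin m → K) :=
    (LinearMap.prodMap (LinearMap.pi fun i => q ∘ₗ LinearMap.proj i) LinearMap.id) ∘ₗ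
      (LinearEquiv.sumArrowLequivProdArrow (Fin l) (Fin m) B K).toLinearMap ∘ₗ
      (w.equivFun.toLinearMap.restrictScalars B)
  have hψ1 : ∀ x i, (ψ x).1 i = q (w.equivFun x (Sum.inl i)) := fun x i => rfl
  have hψ2 : ∀ x i, (ψ x).2 i = w.equivFun x (Sum.inr i) := fun x i => rfl
  have hψ : Function.Surjective ψ := by
    rintro ⟨x, y⟩
    choose x' hx' using fun i => Submodule.mkQ_surjective _ (x i)
    refine ⟨w.equivFun.symm (Sum.elim x' y), Prod.ext (funext fun i => ?_) (funext fun i => ?_)⟩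
    · rw [hψ1, LinearEquiv.apply_symm_apply]
      exact hx' i
    · rw [hψ2, LinearEquiv.apply_symm_apply]
      rfl
  have hker : LinearMap.ker φ = LinearMap.ker ψ := by
    apply le_antisymm
    · intro x hx
      have hmem : (⟨x, hx⟩ : LinearMap.ker φ) ∈ Submodule.span B (Set.range b) := by
        rw [b.span_eq]; trivial
      have hle : Submodule.span B (Set.range b) ≤
          (LinearMap.ker ψ).comap (LinearMap.ker φ).subtype := by
        rw [Submodule.span_le]
        rintro _ ⟨i, rfl⟩
        change ψ (b i) = 0
        refine Prod.ext (funext fun j => ?_) (funext fun j => ?_)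
        · rw [hψ1, ← hw, Module.Basis.equivFun_self]
          refine (hq _).2 ?_
          by_cases hij : i = j
          · exact ⟨1, by simp [hij]⟩
          · exact ⟨0, by simp [hij]⟩
        · rw [hψ2, ← hw, Module.Basis.equivFun_self]
          simp
      exact Submodule.mem_comap.1 (hle hmem)
    · intro x hx
      rw [LinearMap.mem_ker] at hx
      have h1 : ∀ i, ∃ c : B, algebraMap B K c = w.equivFun x (Sum.inl i) := fun i => by
        have := hψ1 x i
        rw [hx] at this
        exact (hq _).1 this.symm
      have h2 : ∀ i, w.equivFun x (Sum.inr i) = 0 := fun i => by rw [← hψ2, hx]; rfl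
      choose c hc using h1
      rw [← w.sum_equivFun x, Fintype.sum_sum_type]
      simp only [h2, zero_smul, Finset.sum_const_zero, add_zero, ← hc, hw, algebraMap_smul]
      exact Submodule.sum_mem _ fun i _ => Submodule.smul_mem _ _ (b i).2
  obtain ⟨e⟩ := LinearMap.nonempty_equiv_of_surjective_of_ker_eq φ ψ hφ hψ hker
  exact ⟨l, m, ⟨e⟩⟩

/-- The structure of finitely generated modules over a discrete valuation ring. -/
theorem IsDiscreteValuationRing.exists_equiv_of_finite [IsDomain B] [IsDiscreteValuationRing B]
    (M : Type*) [AddCommGroup M] [Module B M] [Module.Finite B M] :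
    ∃ (r t : ℕ) (β : Fin t → ℕ), Nonempty (M ≃ₗ[B] (Fin r → B) ×
      (∀ j : Fin t, B ⧸ IsLocalRing.maximalIdeal B ^ β j)) := by
  obtain ⟨r, ι, _, p, hp, e, ⟨E⟩⟩ := Module.equiv_free_prod_directSum B M
  classical
  have h : ∀ i, Submodule.span B {p i ^ e i} = IsLocalRing.maximalIdeal B ^ e i := fun i => by
    rw [(IsDiscreteValuationRing.irreducible_iff_uniformizer _).1 (hp i), Ideal.span_singleton_pow]
  let ε := Fintype.equivFin ι
  exact ⟨r, Fintype.card ι, e ∘ ε.symm, ⟨E ≪≫ₗ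
    (Finsupp.linearEquivFunOnFinite B B (Fin r)).prodCongr
      (DirectSum.linearEquivFunOnFintype B ι (fun i => B ⧸ Submodule.span B {p i ^ e i}) ≪≫ₗ
        LinearEquiv.piCongrRight (fun i => Submodule.quotEquivOfEq _ _ (h i)) ≪≫ₗ
        (LinearEquiv.piCongrLeft B
          (fun i => B ⧸ IsLocalRing.maximalIdeal B ^ e i) ε.symm).symm)⟩⟩

/-- An extension of a finitely generated module by a quotient of a finite-dimensional `K`-space by
a finitely generated submodule. -/
theorem exists_equiv_of_fg_ker_of_finite_coker [IsDomain B] [IsDiscreteValuationRing B]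
    [IsFractionRing B K] {V H : Type*}
    [AddCommGroup V] [Module K V] [Module B V] [IsScalarTower B K V] [Module.Finite K V]
    [AddCommGroup H] [Module B H] (φ : V →ₗ[B] H) (hfg : (LinearMap.ker φ).FG)
    (hfin : Module.Finite B (H ⧸ LinearMap.range φ)) :
    ∃ (l s r t : ℕ) (β : Fin t → ℕ), Nonempty (H ≃ₗ[B]
      ((Fin l → FractionQuotient B K) × (Fin s → K)) ×
        ((Fin r → B) × (∀ j : Fin t, B ⧸ IsLocalRing.maximalIdeal B ^ β j))) := by
  have hfg' : (LinearMap.ker φ.rangeRestrict).FG := by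
    rw [LinearMap.ker_rangeRestrict]
    exact hfg
  obtain ⟨l, s, ⟨eD⟩⟩ := exists_equiv_of_surjective_of_fg_ker (K := K) φ.rangeRestrict
    φ.surjective_rangeRestrict hfg'
  let D := LinearMap.range φ
  obtain ⟨r, t, β, ⟨eF⟩⟩ := IsDiscreteValuationRing.exists_equiv_of_finite (B := B) (H ⧸ D)
  -- The image of a `K`-space is divisible, hence satisfies Baer's criterion; the resulting
  -- retraction splits it off from `H`.
  have hdiv : ∀ b : B, b ≠ 0 → ∀ x : D, ∃ y, b • y = x := by
    intro b hb x
    obtain ⟨v, rfl⟩ := φ.surjective_rangeRestrict x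
    refine ⟨φ.rangeRestrict ((algebraMap B K b)⁻¹ • v), ?_⟩
    rw [← map_smul, ← algebraMap_smul K b, smul_smul, mul_inv_cancel₀ (by simpa using hb), one_smul]
  obtain ⟨ρ, hρ⟩ := (Module.Baer.of_forall_exists_smul_eq hdiv).extension_property
    D.subtype D.injective_subtype LinearMap.id
  exact ⟨l, s, r, t, β, ⟨(lequivProdOfLeftSplitExact (j := D.subtype) (g := D.mkQ)
    D.mkQ_surjective (by simp) hρ).symm ≪≫ₗ eD.prodCongr eF⟩⟩

/-- A version of `exists_equiv_of_fg_ker_of_finite_coker` in which the kernel is finitely generated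
modulo a `K`-subspace. -/
theorem exists_equiv_of_fg_map_ker_of_finite_coker [IsDomain B] [IsDiscreteValuationRing B]
    [IsFractionRing B K] {V H : Type*}
    [AddCommGroup V] [Module K V] [Module B V] [IsScalarTower B K V] [Module.Finite K V]
    [AddCommGroup H] [Module B H] (φ : V →ₗ[B] H) (U : Submodule K V)
    (hU : U.restrictScalars B ≤ LinearMap.ker φ)
    (hfg : ((LinearMap.ker φ).map (U.mkQ.restrictScalars B)).FG)
    (hfin : Module.Finite B (H ⧸ LinearMap.range φ)) :
    ∃ (l s r t : ℕ) (β : Fin t → ℕ), Nonempty (H ≃ₗ[B]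
      ((Fin l → FractionQuotient B K) × (Fin s → K)) ×
        ((Fin r → B) × (∀ j : Fin t, B ⧸ IsLocalRing.maximalIdeal B ^ β j))) := by
  let φ' : (V ⧸ U) →ₗ[B] H := (U.restrictScalars B).liftQ φ hU ∘ₗ
    (Submodule.Quotient.restrictScalarsEquiv B U).symm.toLinearMap
  have hφ' : ∀ v, φ' (U.mkQ v) = φ v := fun v => rfl
  have hrange : LinearMap.range φ' = LinearMap.range φ := by
    ext y
    constructor
    · rintro ⟨x, rfl⟩
      obtain ⟨v, rfl⟩ := U.mkQ_surjective x
      exact ⟨v, rfl⟩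
    · rintro ⟨v, rfl⟩
      exact ⟨U.mkQ v, rfl⟩
  have hker : LinearMap.ker φ' = (LinearMap.ker φ).map (U.mkQ.restrictScalars B) := by
    ext y
    constructor
    · intro hy
      obtain ⟨v, rfl⟩ := U.mkQ_surjective y
      exact ⟨v, hy, rfl⟩
    · rintro ⟨v, hv, rfl⟩
      exact hv
  exact exists_equiv_of_fg_ker_of_finite_coker (K := K) φ' (hker ▸ hfg) (hrange ▸ hfin)

/-- If `X` is a quotient of `F × E` with `F` Noetherian, and `q` kills the elements whose image under
`j` comes from `E`, then `q` maps `j⁻¹(im f)` to a finitely generated submodule. -/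
theorem fg_map_comap_range {B X Y V Q F E : Type*} [CommRing B] [AddCommGroup X] [Module B X]
    [AddCommGroup Y] [Module B Y] [AddCommGroup V] [Module B V] [AddCommGroup Q] [Module B Q]
    [AddCommGroup F] [Module B F] [AddCommGroup E] [Module B E] [IsNoetherian B F]
    (f : X →ₗ[B] Y) (FX : F × E →ₗ[B] X) (hFX : Function.Surjective FX) (j : V →ₗ[B] Y)
    (q : V →ₗ[B] Q) (hq : ∀ w v, f (FX (0, w)) = j v → q v = 0) :
    (((LinearMap.range f).comap j).map q).FG := by
  -- The fibre product over `Y` of the parametrization of the image of `f` with `j`. By `hq`, the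
  -- value of `q` depends only on the `F`-coordinate, and `F` is Noetherian.
  let R : Submodule B ((F × E) × V) := LinearMap.eqLocus (f ∘ₗ FX ∘ₗ LinearMap.fst B _ _)
    (j ∘ₗ LinearMap.snd B _ _)
  let α : R →ₗ[B] F := LinearMap.fst B _ _ ∘ₗ LinearMap.fst B _ _ ∘ₗ R.subtype
  let β : R →ₗ[B] Q := q ∘ₗ LinearMap.snd B _ _ ∘ₗ R.subtype
  have hαβ : LinearMap.ker α ≤ LinearMap.ker β := by
    rintro ⟨⟨⟨b, w⟩, v⟩, hz⟩ hb
    have hb' : b = 0 := hb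
    subst hb'
    exact hq w v hz
  have hβ : ((LinearMap.range f).comap j).map q = LinearMap.range β := by
    apply le_antisymm
    · rintro _ ⟨v, ⟨x, hx⟩, rfl⟩
      obtain ⟨z, rfl⟩ := hFX x
      exact ⟨⟨(z, v), hx⟩, rfl⟩
    · rintro _ ⟨z, rfl⟩
      exact ⟨z.1.2, ⟨_, z.2⟩, rfl⟩
  rw [hβ]
  exact LinearMap.fg_range_of_ker_le α β hαβ

/-- If `Y` is a quotient of `F × E` with `F` Noetherian, then the homology is finitely generated
modulo the classes of the cycles that come from `E`. -/
theorem LinearHomology.finite_quotient {B X Y Z F E : Type*} [CommRing B] [AddCommGroup X]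
    [Module B X] [AddCommGroup Y] [Module B Y] [AddCommGroup Z] [Module B Z]
    [AddCommGroup F] [Module B F] [AddCommGroup E] [Module B E] [IsNoetherian B F]
    {f : X →ₗ[B] Y} {g : Y →ₗ[B] Z} (FY : F × E →ₗ[B] Y) (hFY : Function.Surjective FY)
    (D : Submodule B (LinearHomology f g))
    (hD : ∀ w (hw : FY (0, w) ∈ LinearMap.ker g), Submodule.Quotient.mk ⟨_, hw⟩ ∈ D) :
    Module.Finite B (LinearHomology f g ⧸ D) := by
  let R : Submodule B (F × E) := (LinearMap.ker g).comap FY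
  let α : R →ₗ[B] F := LinearMap.fst B _ _ ∘ₗ R.subtype
  let γ : R →ₗ[B] LinearMap.ker g := (FY ∘ₗ R.subtype).codRestrict _ fun z => z.2
  let β : R →ₗ[B] (LinearHomology f g ⧸ D) := D.mkQ ∘ₗ Submodule.mkQ _ ∘ₗ γ
  have hβ : Function.Surjective β := by
    refine (Submodule.mkQ_surjective _).comp ((Submodule.mkQ_surjective _).comp ?_)
    rintro ⟨y, hy⟩
    obtain ⟨z, rfl⟩ := hFY y
    exact ⟨⟨z, hy⟩, rfl⟩
  have hαβ : LinearMap.ker α ≤ LinearMap.ker β := by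
    rintro ⟨⟨b, v⟩, hz⟩ hb
    have hb' : b = 0 := hb
    subst hb'
    exact (Submodule.Quotient.mk_eq_zero _).2 (hD v hz)
  have := LinearMap.fg_range_of_ker_le α β hαβ
  rw [LinearMap.range_eq_top.2 hβ] at this
  exact ⟨this⟩

/-- The homology of `X → Y → Z` over a discrete valuation ring `B`, if `X` and `Y` are quotients of
modules `Bᵐ × Kᵐ`, and `Y` and `Z` embed into finite-dimensional `K`-spaces. -/
theorem LinearHomology.exists_equiv [IsDomain B] [IsDiscreteValuationRing B] [IsFractionRing B K]
    {X Y Z : Type*} [AddCommGroup X] [Module B X] [AddCommGroup Y] [Module B Y]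
    [AddCommGroup Z] [Module B Z] {f : X →ₗ[B] Y} {g : Y →ₗ[B] Z}
    {ι κ μ : Type*} [Finite ι] [Finite κ]
    (FX : (ι → B) × (ι → K) →ₗ[B] X) (hFX : Function.Surjective FX)
    (FY : (κ → B) × (κ → K) →ₗ[B] Y) (hFY : Function.Surjective FY)
    (eY : Y →ₗ[B] (κ → K)) (heY : Function.Injective eY)
    (eZ : Z →ₗ[B] (μ → K)) (heZ : Function.Injective eZ) :
    ∃ (l s r t : ℕ) (β : Fin t → ℕ), Nonempty (LinearHomology f g ≃ₗ[B]
      ((Fin l → FractionQuotient B K) × (Fin s → K)) ×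
        ((Fin r → B) × (∀ j : Fin t, B ⧸ IsLocalRing.maximalIdeal B ^ β j))) := by
  -- A `B`-linear map between `K`-spaces is automatically `K`-linear. Through the embeddings `eY`
  -- and `eZ`, the restrictions of the maps to the `K`-summands become maps of `K`-spaces, so
  -- kernels and ranges are subspaces.
  let gK : (κ → K) →ₗ[K] (μ → K) := LinearMap.extendScalarsOfIsLocalization (nonZeroDivisors B) K
    (eZ ∘ₗ g ∘ₗ FY ∘ₗ LinearMap.inr B _ _)
  have hgK : ∀ v, gK v = eZ (g (FY (0, v))) := fun v => rfl
  let fK : (ι → K) →ₗ[K] (κ → K) := LinearMap.extendScalarsOfIsLocalization (nonZeroDivisors B) K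
    (eY ∘ₗ f ∘ₗ FX ∘ₗ LinearMap.inr B _ _)
  have hfK : ∀ v, fK v = eY (f (FX (0, v))) := fun v => rfl
  let jK : (κ → K) →ₗ[K] (κ → K) := LinearMap.extendScalarsOfIsLocalization (nonZeroDivisors B) K
    (eY ∘ₗ FY ∘ₗ LinearMap.inr B _ _)
  let V := LinearMap.ker gK
  let W := (LinearMap.range f).submoduleOf (LinearMap.ker g)
  let j : V →ₗ[B] Y := FY ∘ₗ LinearMap.inr B _ _ ∘ₗ V.subtype.restrictScalars B
  let φ : V →ₗ[B] LinearHomology f g := W.mkQ ∘ₗ j.codRestrict _ fun v =>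
    heZ (by rw [map_zero]; exact v.2)
  have hφ0 : ∀ v, φ v = 0 ↔ j v ∈ LinearMap.range f := fun v =>
    Submodule.Quotient.mk_eq_zero _
  -- The cycles from the `K`-summand of `Y` that bound something from the `K`-summand of `X`. They
  -- form a subspace, and the remaining relations involve the Noetherian part of `X`.
  let U : Submodule K V := (LinearMap.range fK).comap (jK ∘ₗ V.subtype)
  have hU : U.restrictScalars B ≤ LinearMap.ker φ := by
    rintro v ⟨w, hw⟩
    refine (hφ0 v).2 ⟨FX (0, w), heY ?_⟩
    rw [← hfK, hw]
    rfl
  have hfg : ((LinearMap.ker φ).map (U.mkQ.restrictScalars B)).FG := by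
    have hker : LinearMap.ker φ = (LinearMap.range f).comap j := by
      ext v
      exact hφ0 v
    rw [hker]
    refine fg_map_comap_range f FX hFX j _ fun w v hwv => ?_
    refine (Submodule.Quotient.mk_eq_zero _).2 ⟨w, ?_⟩
    rw [hfK, hwv]
    rfl
  have hfin : Module.Finite B (LinearHomology f g ⧸ LinearMap.range φ) := by
    refine LinearHomology.finite_quotient FY hFY _ fun w hw => ⟨⟨w, ?_⟩, rfl⟩
    rw [LinearMap.mem_ker, hgK, LinearMap.mem_ker.1 hw, map_zero]
  exact exists_equiv_of_fg_map_ker_of_finite_coker φ U hU hfg hfin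

end DiscreteValuationRing

/-! ### Torsion submodules -/

section GammaTorsion

variable {B : Type*} [CommRing B]

theorem map_mem_gammaTorsion {J : Ideal B} {M N : Type*} [AddCommGroup M] [Module B M]
    [AddCommGroup N] [Module B N] (f : M →ₗ[B] N) {x : M} (hx : x ∈ gammaTorsion J M) :
    f x ∈ gammaTorsion J N := by
  obtain ⟨m, hm⟩ := hx
  exact ⟨m, fun r hr => by rw [← map_smul, hm r hr, map_zero]⟩

theorem gammaTorsion_eq_bot [IsDomain B] {J : Ideal B} (hJ : J ≠ ⊥) (M : Type*)
    [AddCommGroup M] [Module B M] [Module.IsTorsionFree B M] : gammaTorsion J M = ⊥ := by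
  rw [eq_bot_iff]
  rintro x ⟨m, hm⟩
  obtain ⟨r, hr, hr0⟩ := Submodule.exists_mem_ne_zero_of_ne_bot (pow_ne_zero m hJ)
  exact (smul_eq_zero.1 (hm r hr)).resolve_left hr0

theorem gammaTorsion_prod_eq_top {J : Ideal B} {M N : Type*} [AddCommGroup M] [Module B M]
    [AddCommGroup N] [Module B N] (hM : gammaTorsion J M = ⊤) (hN : gammaTorsion J N = ⊤) :
    gammaTorsion J (M × N) = ⊤ := by
  rw [eq_top_iff]
  rintro ⟨x, y⟩ -
  have hx := map_mem_gammaTorsion (LinearMap.inl B M N) (hM.ge (Submodule.mem_top (x := x)))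
  have hy := map_mem_gammaTorsion (LinearMap.inr B M N) (hN.ge (Submodule.mem_top (x := y)))
  simpa using add_mem hx hy

theorem gammaTorsion_pi_eq_top {J : Ideal B} {ι : Type*} [Finite ι] {M : ι → Type*}
    [∀ i, AddCommGroup (M i)] [∀ i, Module B (M i)] (hM : ∀ i, gammaTorsion J (M i) = ⊤) :
    gammaTorsion J (∀ i, M i) = ⊤ := by
  classical
  have := Fintype.ofFinite ι
  rw [eq_top_iff]
  rintro x -
  rw [← Finset.univ_sum_single x]
  exact Submodule.sum_mem _ fun i _ => map_mem_gammaTorsion (LinearMap.single B M i)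
    ((hM i).ge Submodule.mem_top)

theorem gammaTorsion_quotient_pow_eq_top (J : Ideal B) (n : ℕ) :
    gammaTorsion J (B ⧸ J ^ n) = ⊤ := by
  rw [eq_top_iff]
  rintro x -
  obtain ⟨b, rfl⟩ := Ideal.Quotient.mk_surjective x
  refine ⟨n, fun r hr => ?_⟩
  rw [Algebra.smul_def, Ideal.Quotient.algebraMap_eq, ← map_mul, Ideal.Quotient.eq_zero_iff_mem]
  exact Ideal.mul_mem_right _ _ hr

/-- A denominator is associated to a power `ϖ ^ n` of a uniformizer, so the `n`-th power of the
maximal ideal makes the fraction integral. -/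
theorem gammaTorsion_fractionQuotient_eq_top [IsDomain B] [IsDiscreteValuationRing B] (K : Type*)
    [Field K] [Algebra B K] [IsFractionRing B K] :
    gammaTorsion (IsLocalRing.maximalIdeal B) (FractionQuotient B K) = ⊤ := by
  rw [eq_top_iff]
  rintro x -
  obtain ⟨k, rfl⟩ := Submodule.mkQ_surjective _ x
  obtain ⟨a, b, hb, rfl⟩ := IsFractionRing.div_surjective (A := B) k
  have hb0 : b ≠ 0 := nonZeroDivisors.ne_zero hb
  have hbK : algebraMap B K b ≠ 0 := by simpa using hb0
  obtain ⟨ϖ, hϖ⟩ := IsDiscreteValuationRing.exists_irreducible B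
  obtain ⟨n, hn⟩ := IsDiscreteValuationRing.associated_pow_irreducible hb0 hϖ
  refine ⟨n, fun r hr => ?_⟩
  rw [(IsDiscreteValuationRing.irreducible_iff_uniformizer _).1 hϖ, Ideal.span_singleton_pow,
    Ideal.mem_span_singleton] at hr
  obtain ⟨c, rfl⟩ := hn.dvd.trans hr
  rw [← map_smul]
  refine (Submodule.Quotient.mk_eq_zero _).2 ⟨c * a, ?_⟩
  rw [Algebra.linearMap_apply, Algebra.smul_def, map_mul, map_mul]
  field_simp

variable [IsDomain B] [IsDiscreteValuationRing B] {K : Type*} [Field K] [Algebra B K]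
  [IsFractionRing B K] {H : Type*} [AddCommGroup H] [Module B H] {l s r t : ℕ} {β : Fin t → ℕ}

/-- The maximal torsion-free quotient of a module of the form given by
`LinearHomology.exists_equiv`. -/
theorem nonempty_quotient_gammaTorsion_equiv
    (e : H ≃ₗ[B] ((Fin l → FractionQuotient B K) × (Fin s → K)) ×
        ((Fin r → B) × (∀ j : Fin t, B ⧸ IsLocalRing.maximalIdeal B ^ β j))) :
    Nonempty ((H ⧸ gammaTorsion (IsLocalRing.maximalIdeal B) H) ≃ₗ[B]
      (Fin r → B) × (Fin s → K)) := by
  have hm := IsDiscreteValuationRing.not_a_field B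
  let φ : H →ₗ[B] (Fin r → B) × (Fin s → K) :=
    ((LinearMap.fst B _ _ ∘ₗ LinearMap.snd B _ _).prod
      (LinearMap.snd B _ _ ∘ₗ LinearMap.fst B _ _)) ∘ₗ e.toLinearMap
  let i : ((Fin l → FractionQuotient B K) ×
      (∀ j : Fin t, B ⧸ IsLocalRing.maximalIdeal B ^ β j)) →ₗ[B] H :=
    e.symm.toLinearMap ∘ₗ LinearMap.prodMap (LinearMap.inl B _ _) (LinearMap.inr B _ _)
  have hφ : Function.Surjective φ := by
    rintro ⟨x, y⟩
    exact ⟨e.symm ((0, y), (x, 0)), by simp [φ]⟩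
  -- Torsion dies in the torsion-free target of `φ`; conversely the kernel of `φ` is the image under
  -- `i` of the two torsion summands.
  have hker : gammaTorsion (IsLocalRing.maximalIdeal B) H = LinearMap.ker φ := by
    apply le_antisymm
    · intro x hx
      have := map_mem_gammaTorsion φ hx
      rwa [gammaTorsion_eq_bot hm] at this
    · intro x hx
      have h1 : (e x).2.1 = 0 := congrArg Prod.fst (LinearMap.mem_ker.1 hx)
      have h2 : (e x).1.2 = 0 := congrArg Prod.snd (LinearMap.mem_ker.1 hx)
      have hix : i ((e x).1.1, (e x).2.2) = x := by
        apply e.injective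
        simp [i, Prod.ext_iff, h1, h2]
      rw [← hix]
      refine map_mem_gammaTorsion i ?_
      rw [gammaTorsion_prod_eq_top
        (gammaTorsion_pi_eq_top fun _ => gammaTorsion_fractionQuotient_eq_top K)
        (gammaTorsion_pi_eq_top fun _ => gammaTorsion_quotient_pow_eq_top _ _)]
      trivial
  exact ⟨Submodule.quotEquivOfEq _ _ hker ≪≫ₗ φ.quotKerEquivOfSurjective hφ⟩

/-- The torsion of a module of the form given by `LinearHomology.exists_equiv`. -/
theorem nonempty_gammaTorsion_equiv
    (e : H ≃ₗ[B] ((Fin l → FractionQuotient B K) × (Fin s → K)) ×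
        ((Fin r → B) × (∀ j : Fin t, B ⧸ IsLocalRing.maximalIdeal B ^ β j))) :
    Nonempty (gammaTorsion (IsLocalRing.maximalIdeal B) H ≃ₗ[B]
      (Fin l → FractionQuotient B K) ×
        (∀ j : Fin t, B ⧸ IsLocalRing.maximalIdeal B ^ β j)) := by
  have hm := IsDiscreteValuationRing.not_a_field B
  let φ : H →ₗ[B] (Fin r → B) × (Fin s → K) :=
    ((LinearMap.fst B _ _ ∘ₗ LinearMap.snd B _ _).prod
      (LinearMap.snd B _ _ ∘ₗ LinearMap.fst B _ _)) ∘ₗ e.toLinearMap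
  let i : ((Fin l → FractionQuotient B K) ×
      (∀ j : Fin t, B ⧸ IsLocalRing.maximalIdeal B ^ β j)) →ₗ[B] H :=
    e.symm.toLinearMap ∘ₗ LinearMap.prodMap (LinearMap.inl B _ _) (LinearMap.inr B _ _)
  let i' := i.codRestrict (gammaTorsion (IsLocalRing.maximalIdeal B) H) fun x => by
    refine map_mem_gammaTorsion i ?_
    rw [gammaTorsion_prod_eq_top
        (gammaTorsion_pi_eq_top fun _ => gammaTorsion_fractionQuotient_eq_top K)
        (gammaTorsion_pi_eq_top fun _ => gammaTorsion_quotient_pow_eq_top _ _)]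
    trivial
  refine ⟨(LinearEquiv.ofBijective i' ⟨?_, ?_⟩).symm⟩
  · intro x y hxy
    have := e.symm.injective (congrArg Subtype.val hxy)
    exact Prod.ext (congrArg (fun z => z.1.1) this) (congrArg (fun z => z.2.2) this)
  · rintro ⟨x, hx⟩
    have hφ := map_mem_gammaTorsion φ hx
    rw [gammaTorsion_eq_bot hm] at hφ
    have h1 : (e x).2.1 = 0 := congrArg Prod.fst ((Submodule.mem_bot B).1 hφ)
    have h2 : (e x).1.2 = 0 := congrArg Prod.snd ((Submodule.mem_bot B).1 hφ)
    refine ⟨((e x).1.1, (e x).2.2), Subtype.ext ?_⟩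
    apply e.injective
    change e (i _) = e x
    simp [i, Prod.ext_iff, h1, h2]

end GammaTorsion

/-! ### Torsion at a maximal ideal and localization -/

section Localization

/-- The `p`-torsion of a module does not change under localization at a maximal ideal `p`. -/
theorem nonempty_gammaTorsion_localization_equiv {A B M M' : Type*} [CommRing A] [CommRing B]
    [Algebra A B] (p : Ideal A) [p.IsMaximal] [IsLocalization.AtPrime B p] [IsLocalRing B]
    (hp : p.FG)
    [AddCommGroup M] [Module A M] [AddCommGroup M'] [Module A M'] [Module B M']
    [IsScalarTower A B M'] (f : M →ₗ[A] M') [IsLocalizedModule p.primeCompl f] :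
    Nonempty (gammaTorsion p M ≃ₗ[A] gammaTorsion (IsLocalRing.maximalIdeal B) M') := by
  have hmap : ∀ k, IsLocalRing.maximalIdeal B ^ k = (p ^ k).map (algebraMap A B) := fun k => by
    rw [Ideal.map_pow, IsLocalization.AtPrime.map_eq_maximalIdeal p B]
  -- As `p` is maximal, an element outside `p` is invertible modulo every power of `p`, so it
  -- already acts bijectively on what `p ^ k` kills.
  have hinv : ∀ (k : ℕ) (s : p.primeCompl), ∃ a, ∃ r ∈ p ^ k, a * (s : A) + r = 1 := by
    intro k s
    have h1 : IsCoprime p (Ideal.span {(s : A)}) := by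
      obtain ⟨a, r, hr, h⟩ := ‹p.IsMaximal›.exists_inv s.2
      exact Ideal.isCoprime_iff_exists.2 ⟨r, hr, a * s, Ideal.mem_span_singleton'.2 ⟨a, rfl⟩,
        by rw [add_comm, h]⟩
    obtain ⟨r, hr, b, hb, h⟩ := Ideal.isCoprime_iff_exists.1 (h1.pow_left (m := k))
    obtain ⟨a, rfl⟩ := Ideal.mem_span_singleton'.1 hb
    exact ⟨a, r, hr, by rw [add_comm, h]⟩
  let f' : gammaTorsion p M →ₗ[A] gammaTorsion (IsLocalRing.maximalIdeal B) M' :=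
    { toFun := fun x => ⟨f x, by
        obtain ⟨k, hk⟩ := x.2
        refine ⟨k, fun r hr => ?_⟩
        rw [hmap] at hr
        have hle : (p ^ k).map (algebraMap A B) ≤
            LinearMap.ker (LinearMap.toSpanSingleton B M' (f x)) := by
          rw [Ideal.map_le_iff_le_comap]
          intro a ha
          rw [Ideal.mem_comap, LinearMap.mem_ker, LinearMap.toSpanSingleton_apply,
            algebraMap_smul, ← map_smul, hk a ha, map_zero]
        exact hle hr⟩
      map_add' := fun x y => Subtype.ext (map_add f _ _)
      map_smul' := fun a x => Subtype.ext (map_smul f _ _) }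
  refine ⟨LinearEquiv.ofBijective f' ⟨?_, ?_⟩⟩
  · rw [← LinearMap.ker_eq_bot, eq_bot_iff]
    rintro ⟨x, k, hk⟩ hx
    have hx' : f x = 0 := congrArg Subtype.val hx
    obtain ⟨s, hs⟩ := (IsLocalizedModule.eq_zero_iff p.primeCompl f).1 hx'
    obtain ⟨a, r, hr, har⟩ := hinv k s
    refine Subtype.ext ?_
    change x = 0
    rw [← one_smul A x, ← har, add_smul, mul_smul, hk r hr, add_zero]
    exact (congrArg (a • ·) hs).trans (smul_zero a)
  · rintro ⟨y, k, hk⟩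
    obtain ⟨⟨x, s⟩, hxs⟩ := IsLocalizedModule.surj p.primeCompl f y
    have hk' : ∀ r ∈ p ^ k, r • y = 0 := fun r hr => by
      rw [← algebraMap_smul B]
      exact hk _ (by rw [hmap]; exact Ideal.mem_map_of_mem _ hr)
    have hkill : ∀ r ∈ p ^ k, ∃ s' : p.primeCompl, s' • r • x = 0 := fun r hr => by
      refine (IsLocalizedModule.eq_zero_iff p.primeCompl f).1 ?_
      rw [map_smul, ← hxs, Submonoid.smul_def, smul_comm, hk' r hr, smul_zero]
    -- Finite generation of `p ^ k` allows one multiplier for all `r`: the product of the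
    -- multipliers for the generators.
    obtain ⟨s', hs'⟩ : ∃ s' : p.primeCompl, ∀ r ∈ p ^ k, (s' : A) • r • x = 0 := by
      obtain ⟨T, hT⟩ := hp.pow (n := k)
      choose! c hc using hkill
      refine ⟨∏ r ∈ T, c r, fun r hr => ?_⟩
      have hle : p ^ k ≤ LinearMap.ker (((∏ r ∈ T, c r : p.primeCompl) : A) •
          LinearMap.toSpanSingleton A M x) := by
        rw [← hT]
        refine Submodule.span_le.2 fun r hr => ?_
        change ((∏ r ∈ T, c r : p.primeCompl) : A) • r • x = 0
        obtain ⟨d, hd⟩ := Finset.dvd_prod_of_mem c hr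
        have hr' : r ∈ p ^ k := by rw [← hT]; exact Submodule.subset_span hr
        rw [hd, mul_comm, Submonoid.coe_mul, mul_smul]
        exact (congrArg ((d : A) • ·) (hc r hr')).trans (smul_zero _)
      exact hle hr
    -- Here `s • y = f x`. With `a` inverse to `s' * s` modulo `p ^ k`, the preimage of `y` is `(a *
    -- s') • x`: the factor `s'` makes it torsion, and `r` kills `y`.
    obtain ⟨a, r, hr, har⟩ := hinv k (s' * s)
    refine ⟨⟨(a * s') • x, k, fun r hr => ?_⟩, Subtype.ext ?_⟩
    · rw [smul_comm, mul_smul, hs' r hr, smul_zero]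
    · change f ((a * s') • x) = y
      rw [map_smul, ← hxs, Submonoid.smul_def, smul_smul, mul_assoc, ← Submonoid.coe_mul]
      conv_rhs => rw [← one_smul A y, ← har, add_smul, hk' r hr, add_zero]

end Localization

/-! ### Injective hulls of residue fields -/

section InjectiveHull

universe v

/-- Injective hulls are unique up to isomorphism. -/
theorem IsInjectiveHull.nonempty_equiv {A : Type v} [CommRing A] {N E E' : Type v}
    [AddCommGroup N] [Module A N] [AddCommGroup E] [Module A E] [AddCommGroup E'] [Module A E']
    {ι : N →ₗ[A] E} {ι' : N →ₗ[A] E'} (h : IsInjectiveHull ι) (h' : IsInjectiveHull ι') :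
    Nonempty (E ≃ₗ[A] E') := by
  obtain ⟨f, hf⟩ := h'.moduleInjective.out ι h.injective ι'
  have hfinj : LinearMap.ker f = ⊥ := by
    refine h.essential _ (eq_bot_iff.2 ?_)
    rintro _ ⟨hx, y, rfl⟩
    have hy : ι' y = 0 := (hf y).symm.trans hx
    rw [h'.injective (hy.trans (map_zero ι').symm), map_zero]
    exact Submodule.zero_mem _
  -- The retraction `g` of `f` is injective because its kernel misses the essential image of `N`; an
  -- injective retraction forces `f` to be surjective.
  obtain ⟨g, hg⟩ := h.moduleInjective.out f (LinearMap.ker_eq_bot.1 hfinj) LinearMap.id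
  have hginj : LinearMap.ker g = ⊥ := by
    refine h'.essential _ (eq_bot_iff.2 ?_)
    rintro _ ⟨hx, y, rfl⟩
    have hy : ι y = 0 := by
      have hgy : g (ι' y) = 0 := hx
      rwa [← hf, hg] at hgy
    rw [h.injective (hy.trans (map_zero ι).symm), map_zero]
    exact Submodule.zero_mem _
  refine ⟨LinearEquiv.ofBijective f ⟨LinearMap.ker_eq_bot.1 hfinj, fun y => ⟨g y, ?_⟩⟩⟩
  exact LinearMap.ker_eq_bot.1 hginj (hg _)

/-- Injectivity descends along restriction of scalars to a ring over which the ring is flat. -/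
theorem Module.Injective.restrictScalars {A B Q : Type v} [CommRing A] [CommRing B] [Algebra A B]
    [Module.Flat A B] [AddCommGroup Q] [Module A Q] [Module B Q] [IsScalarTower A B Q]
    (h : Module.Injective B Q) : Module.Injective A Q := by
  refine ⟨fun X Y _ _ _ _ k hk g => ?_⟩
  -- Extend the adjoint map `B ⊗ X → Q` along `B ⊗ X → B ⊗ Y`, injective by flatness, then restrict
  -- to `1 ⊗ Y`.
  obtain ⟨f, hf⟩ := h.out (k.baseChange B)
    (Module.Flat.lTensor_preserves_injective_linearMap k hk)
    (LinearMap.liftBaseChange B g)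
  refine ⟨f.restrictScalars A ∘ₗ TensorProduct.mk A B Y 1, fun x => ?_⟩
  have := hf (1 ⊗ₜ x)
  simpa using this

/-- For a maximal ideal `p` such that `A_p` is a discrete valuation ring, the injective hull of
`A / p` is `K / A_p`. -/
theorem nonempty_fractionQuotient_equiv_injectiveHull {A B K : Type v} [CommRing A] [CommRing B]
    [Algebra A B] (p : Ideal A) [p.IsMaximal] [IsLocalization.AtPrime B p] [IsDomain B]
    [IsDiscreteValuationRing B] [Field K] [Algebra B K] [IsFractionRing B K] [Algebra A K]
    [IsScalarTower A B K] :
    Nonempty (FractionQuotient B K ≃ₗ[A] InjectiveHull A (A ⧸ p)) := by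
  obtain ⟨ι, hι⟩ : ∃ ι : (A ⧸ p) →ₗ[A] InjectiveHull A (A ⧸ p), IsInjectiveHull ι :=
    (exists_isInjectiveHull A (A ⧸ p)).choose_spec
  obtain ⟨ϖ, hϖ⟩ := IsDiscreteValuationRing.exists_irreducible B
  have hm := (IsDiscreteValuationRing.irreducible_iff_uniformizer _).1 hϖ
  have hϖK : algebraMap B K ϖ ≠ 0 := by simpa using hϖ.ne_zero
  let q := (LinearMap.range (Algebra.linearMap B K)).mkQ
  have hq : ∀ x : K, q x = 0 ↔ ∃ c : B, algebraMap B K c = x := fun x =>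
    Submodule.Quotient.mk_eq_zero _
  -- The class of `1/ϖ` has annihilator exactly the maximal ideal, so over `A` it spans a copy of `A
  -- / p`, the socle of `K / B`.
  let y := q (algebraMap B K ϖ)⁻¹
  have hy : ∀ b : B, b • y = 0 ↔ b ∈ IsLocalRing.maximalIdeal B := fun b => by
    rw [← map_smul, hq, hm, Ideal.mem_span_singleton']
    refine exists_congr fun c => ?_
    rw [Algebra.smul_def, eq_mul_inv_iff_mul_eq₀ hϖK, ← map_mul,
      (FaithfulSMul.algebraMap_injective B K).eq_iff]
  have hyA : ∀ a : A, a • y = 0 ↔ a ∈ p := fun a => by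
    rw [← algebraMap_smul B, hy, IsLocalization.AtPrime.to_map_mem_maximal_iff B p]
  let j : (A ⧸ p) →ₗ[A] FractionQuotient B K := Submodule.liftQ p (LinearMap.toSpanSingleton A _ y)
    fun a ha => (hyA a).2 ha
  have hj : ∀ a : A, j (Submodule.Quotient.mk a) = a • y := fun a => rfl
  have hflat : Module.Flat A B := IsLocalization.flat B p.primeCompl
  have hinj : Module.Injective B (FractionQuotient B K) :=
    (Module.Baer.of_forall_exists_smul_eq FractionQuotient.exists_smul_eq).injective
  refine IsInjectiveHull.nonempty_equiv (ι := j) ⟨hinj.restrictScalars, ?_, fun W hW => ?_⟩ hι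
  · rw [← LinearMap.ker_eq_bot, eq_bot_iff]
    intro x hx
    obtain ⟨a, rfl⟩ := Submodule.Quotient.mk_surjective _ x
    exact (Submodule.Quotient.mk_eq_zero _).2 ((hyA a).1 hx)
  -- Essentiality: if `p ^ (k + 1)` kills `x ∈ W`, then each `r • x` with `r ∈ p ^ k` lies in the
  -- socle and in `W`, hence vanishes, and the induction hypothesis applies. Every element of `K /
  -- B` is killed by some power of `p`.
  · have key : ∀ (k : ℕ) (x : FractionQuotient B K), x ∈ W →
        (∀ r ∈ p ^ k, r • x = 0) → x = 0 := by
      intro k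
      induction k with
      | zero => exact fun x _ hx => by simpa using hx 1
      | succ k ih =>
        intro x hxW hx
        refine ih x hxW fun r hr => ?_
        have hr0 : ∀ a ∈ p, a • r • x = 0 := fun a ha => by
          rw [smul_smul]
          exact hx _ (by rw [pow_succ']; exact Ideal.mul_mem_mul ha hr)
        obtain ⟨z, hz⟩ := Submodule.mkQ_surjective _ (r • x)
        have hϖz : q (ϖ • z) = 0 := by
          have hle : IsLocalRing.maximalIdeal B ≤
              LinearMap.ker (LinearMap.toSpanSingleton B (FractionQuotient B K) (r • x)) := by
            rw [← IsLocalization.AtPrime.map_eq_maximalIdeal p B, Ideal.map_le_iff_le_comap]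
            intro a ha
            rw [Ideal.mem_comap, LinearMap.mem_ker, LinearMap.toSpanSingleton_apply,
              algebraMap_smul, hr0 a ha]
          rw [map_smul]
          exact (congrArg (ϖ • ·) hz).trans (hle hϖ.not_isUnit)
        obtain ⟨b, hb⟩ := (hq _).1 hϖz
        -- Only the residue of `b` matters, since the maximal ideal kills `y`; and `A` surjects onto
        -- the residue field of `B`.
        obtain ⟨a, ha⟩ : ∃ a : A, b - algebraMap A B a ∈ IsLocalRing.maximalIdeal B := by
          obtain ⟨a, ha⟩ := Ideal.Quotient.mk_surjective
            ((IsLocalization.AtPrime.equivQuotMaximalIdeal p B).symm (Ideal.Quotient.mk _ b))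
          refine ⟨a, ?_⟩
          rw [← Ideal.Quotient.eq, ← IsLocalization.AtPrime.equivQuotMaximalIdeal_apply_mk p B, ha,
            RingEquiv.apply_symm_apply]
        have hrx : r • x = a • y := by
          have h1 : r • x = b • y := by
            rw [← hz, ← map_smul, Algebra.smul_def b, hb, Algebra.smul_def, mul_comm,
              inv_mul_cancel_left₀ hϖK]
          rw [h1, ← sub_eq_zero, ← algebraMap_smul B a, ← sub_smul]
          exact (hy _).2 ha
        have : r • x ∈ W ⊓ LinearMap.range j :=
          ⟨W.smul_mem r hxW, ⟨Submodule.Quotient.mk a, by rw [hj, hrx]⟩⟩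
        rw [hW] at this
        exact this
    rw [eq_bot_iff]
    intro x hx
    obtain ⟨k, hk⟩ := (gammaTorsion_fractionQuotient_eq_top (B := B) K).ge
      (Submodule.mem_top (x := x))
    refine key k x hx fun r hr => ?_
    rw [← algebraMap_smul B]
    refine hk _ ?_
    rw [← IsLocalization.AtPrime.map_eq_maximalIdeal p B, ← Ideal.map_pow]
    exact Ideal.mem_map_of_mem _ hr

end InjectiveHull

/-! ### The completion of a discrete valuation ring -/

section Completion

open IsLocalRing

variable (B : Type*) [CommRing B] [IsDomain B] [IsDiscreteValuationRing B]

/-- The completion is Hausdorff, so there is a last power `ϖ ^ n` dividing `x`; the cofactor is then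
outside the maximal ideal, hence a unit. -/
theorem AdicCompletion.exists_eq_unit_mul_pow {ϖ : B} (hϖ : Irreducible ϖ)
    {x : AdicCompletion (maximalIdeal B) B} (hx : x ≠ 0) :
    ∃ (n : ℕ) (w : (AdicCompletion (maximalIdeal B) B)ˣ), x = algebraMap _ _ ϖ ^ n * w := by
  have hm : maximalIdeal (AdicCompletion (maximalIdeal B) B) =
      Ideal.span {algebraMap B (AdicCompletion (maximalIdeal B) B) ϖ} := by
    rw [AdicCompletion.maximalIdeal_eq_map,
      (IsDiscreteValuationRing.irreducible_iff_uniformizer _).1 hϖ, Ideal.map_span,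
      Set.image_singleton]
  have hex : ∃ n, x ∉ maximalIdeal (AdicCompletion (maximalIdeal B) B) ^ n := by
    by_contra! h
    refine hx (IsHausdorff.haus (I := maximalIdeal (AdicCompletion (maximalIdeal B) B))
      inferInstance x fun n => ?_)
    rw [SModEq.zero, smul_eq_mul, Ideal.mul_top]
    exact h n
  classical
  have hn := Nat.find_spec hex
  have hmin := fun k => Nat.find_min (m := k) hex
  generalize Nat.find hex = n at hn hmin
  obtain _ | n := n
  · simp at hn
  · have hxn := not_not.1 (hmin n (Nat.lt_succ_self n))
    rw [hm, Ideal.span_singleton_pow, Ideal.mem_span_singleton] at hxn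
    obtain ⟨w, rfl⟩ := hxn
    have hw : IsUnit w := by
      by_contra hw
      have hw' : w ∈ maximalIdeal (AdicCompletion (maximalIdeal B) B) := hw
      refine hn ?_
      rw [pow_succ]
      refine Ideal.mul_mem_mul ?_ hw'
      exact Ideal.pow_mem_pow (by rw [hm]; exact Ideal.mem_span_singleton_self _) n
    exact ⟨n, hw.unit, rfl⟩

theorem AdicCompletion.algebraMap_self_injective :
    Function.Injective (algebraMap B (AdicCompletion (maximalIdeal B) B)) :=
  AdicCompletion.of_injective (maximalIdeal B) B

instance AdicCompletion.isDomain_of_isDiscreteValuationRing :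
    IsDomain (AdicCompletion (maximalIdeal B) B) := by
  obtain ⟨ϖ, hϖ⟩ := IsDiscreteValuationRing.exists_irreducible B
  have : NoZeroDivisors (AdicCompletion (maximalIdeal B) B) := ⟨by
    intro x y hxy
    by_contra! h
    obtain ⟨n, w, hx⟩ := exists_eq_unit_mul_pow B hϖ h.1
    obtain ⟨k, z, hy⟩ := exists_eq_unit_mul_pow B hϖ h.2
    -- A vanishing product would make `ϖ ^ (n + k)` zero in the completion, into which `B` embeds.
    rw [hx, hy, mul_mul_mul_comm, ← pow_add, ← Units.val_mul, Units.mul_left_eq_zero,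
      ← map_pow, map_eq_zero_iff _ (algebraMap_self_injective B)] at hxy
    exact pow_ne_zero _ hϖ.ne_zero hxy⟩
  exact NoZeroDivisors.to_isDomain _

instance AdicCompletion.isDiscreteValuationRing :
    IsDiscreteValuationRing (AdicCompletion (maximalIdeal B) B) := by
  obtain ⟨ϖ, hϖ⟩ := IsDiscreteValuationRing.exists_irreducible B
  refine IsDiscreteValuationRing.ofHasUnitMulPowIrreducibleFactorization
    ⟨algebraMap _ _ ϖ, ?_, fun {x} hx => ?_⟩
  · have hne : algebraMap B (AdicCompletion (maximalIdeal B) B) ϖ ≠ 0 := by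
      rw [Ne, map_eq_zero_iff _ (algebraMap_self_injective B)]
      exact hϖ.ne_zero
    refine ((Ideal.span_singleton_prime hne).1 ?_).irreducible
    rw [← Set.image_singleton, ← Ideal.map_span,
      ← (IsDiscreteValuationRing.irreducible_iff_uniformizer _).1 hϖ,
      ← AdicCompletion.maximalIdeal_eq_map]
    infer_instance
  · obtain ⟨n, w, hw⟩ := exists_eq_unit_mul_pow B hϖ hx
    exact ⟨n, w, hw.symm⟩

end Completion

/-! ### Homogeneous components of localizations of polynomial rings at terms -/

section Laurent

variable {A : Type*} [CommRing A] {n : ℕ}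

/-- An exponent vector as an element of `ℤⁿ`. -/
def intExponent (e : Fin n →₀ ℕ) : Fin n → ℤ := fun k => e k

theorem intExponent_add (d e : Fin n →₀ ℕ) :
    intExponent (d + e) = intExponent d + intExponent e := by
  ext k
  simp [intExponent]

/-- The map from a polynomial ring to the ring of Laurent polynomials over `A_α`. -/
noncomputable def laurentMap (n : ℕ) (α : A) : MvPolynomial (Fin n) A →ₐ[A]
    AddMonoidAlgebra (Localization.Away α) (Fin n → ℤ) :=
  MvPolynomial.aeval fun k => AddMonoidAlgebra.single (Pi.single k 1) 1

theorem laurentMap_monomial (α : A) (d : Fin n →₀ ℕ) (b : A) :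
    laurentMap n α (MvPolynomial.monomial d b) =
      AddMonoidAlgebra.single (intExponent d) (algebraMap A _ b) := by
  have h1 : ∀ d : Fin n →₀ ℕ, laurentMap n α (MvPolynomial.monomial d 1) =
      AddMonoidAlgebra.single (intExponent d) 1 := fun d => by
    induction d using Finsupp.induction_linear with
    | zero =>
      have : intExponent (0 : Fin n →₀ ℕ) = 0 := by ext; simp [intExponent]
      rw [this]
      exact map_one _
    | add d e hd he =>
      have : MvPolynomial.monomial (d + e) (1 : A) =
        MvPolynomial.monomial d 1 * MvPolynomial.monomial e 1 := by
        rw [MvPolynomial.monomial_mul, one_mul]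
      rw [this, map_mul, hd, he, AddMonoidAlgebra.single_mul_single, one_mul, intExponent_add]
    | single k m =>
      rw [← MvPolynomial.X_pow_eq_monomial, map_pow, laurentMap, MvPolynomial.aeval_X,
        AddMonoidAlgebra.single_pow, one_pow]
      congr 1
      ext j
      by_cases h : j = k
      · subst h; simp [intExponent]
      · simp [intExponent, h]
  have h2 : MvPolynomial.monomial d b = algebraMap A _ b * MvPolynomial.monomial d 1 := by
    rw [MvPolynomial.algebraMap_eq, MvPolynomial.C_mul_monomial, mul_one]
  rw [h2, map_mul, h1, AlgHom.commutes, ← Algebra.smul_def, AddMonoidAlgebra.smul_single,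
    Algebra.smul_def, mul_one]

variable {f : MvPolynomial (Fin n) A} {e : Fin n →₀ ℕ} {α : A}

theorem isUnit_laurentMap (hf : f = MvPolynomial.monomial e α) : IsUnit (laurentMap n α f) := by
  obtain ⟨β, hβ⟩ := isUnit_iff_exists_inv.1
    (IsLocalization.Away.algebraMap_isUnit (S := Localization.Away α) α)
  refine isUnit_iff_exists_inv.2 ⟨AddMonoidAlgebra.single (-intExponent e) β, ?_⟩
  rw [hf, laurentMap_monomial, AddMonoidAlgebra.single_mul_single, hβ, add_neg_cancel]
  rfl

/-- The localization of a polynomial ring at a term `α Xᵉ` maps to Laurent polynomials over `A_α`. -/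
noncomputable def awayLaurent (hf : f = MvPolynomial.monomial e α) : Localization.Away f →ₐ[A]
    AddMonoidAlgebra (Localization.Away α) (Fin n → ℤ) :=
  IsLocalization.liftAlgHom (M := Submonoid.powers f) (f := laurentMap n α) (by
    rintro ⟨_, m, rfl⟩
    rw [map_pow]
    exact (isUnit_laurentMap hf).pow m)

theorem awayLaurent_algebraMap (hf : f = MvPolynomial.monomial e α) (p : MvPolynomial (Fin n) A) :
    awayLaurent hf (algebraMap _ _ p) = laurentMap n α p :=
  IsLocalization.lift_eq _ _

/-- The coefficient of `Xᵘ` of an element of the localization of a polynomial ring at `α Xᵉ`. -/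
noncomputable def awayCoeff (hf : f = MvPolynomial.monomial e α) (u : Fin n → ℤ) :
    Localization.Away f →ₗ[A] Localization.Away α where
  toFun x := (awayLaurent hf x).coeff u
  map_add' x y := by rw [map_add]; rfl
  map_smul' r x := by rw [map_smul]; rfl

/-- The denominator is a power of an arbitrary term `α₀ X^e₀`, not only of `f`: an element of the
localization at `f` keeps its denominator when it is mapped to a further localization. -/
theorem awayCoeff_mul_pow (hf : f = MvPolynomial.monomial e α) (u : Fin n → ℤ)
    {x : Localization.Away f} {m : ℕ} {d e₀ : Fin n →₀ ℕ} {b α₀ : A}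
    (hx : x * algebraMap (MvPolynomial (Fin n) A) _ (MvPolynomial.monomial e₀ α₀ ^ m) =
      algebraMap (MvPolynomial (Fin n) A) _ (MvPolynomial.monomial d b)) :
    awayCoeff hf u x * algebraMap A _ (α₀ ^ m) =
      (AddMonoidAlgebra.single (intExponent d) (algebraMap A (Localization.Away α) b)).coeff
        (u + intExponent (m • e₀)) := by
  have h := congrArg (awayLaurent hf) hx
  rw [map_mul, awayLaurent_algebraMap, awayLaurent_algebraMap, MvPolynomial.monomial_pow,
    laurentMap_monomial, laurentMap_monomial] at h
  rw [← h, AddMonoidAlgebra.coeff_mul_single_apply, add_neg_cancel_right]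
  rfl

theorem intExponent_eq_add_iff {d e : Fin n →₀ ℕ} {m : ℕ} {u : Fin n → ℤ} :
    intExponent d = u + intExponent (m • e) ↔ ∀ k, (d k : ℤ) - m * e k = u k := by
  rw [funext_iff]
  refine forall_congr' fun k => ?_
  simp only [intExponent, Pi.add_apply, Finsupp.smul_apply, smul_eq_mul, Nat.cast_mul]
  rw [sub_eq_iff_eq_add]

theorem awayCoeff_mul_pow_of_eq (hf : f = MvPolynomial.monomial e α) {u : Fin n → ℤ}
    {x : Localization.Away f} {m : ℕ} {d : Fin n →₀ ℕ} {b : A}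
    (hd : ∀ k, (d k : ℤ) - m * e k = u k)
    (hx : x * algebraMap (MvPolynomial (Fin n) A) _ (f ^ m) =
      algebraMap (MvPolynomial (Fin n) A) _ (MvPolynomial.monomial d b)) :
    awayCoeff hf u x * algebraMap A _ (α ^ m) = algebraMap A _ b := by
  have hx' : x * algebraMap (MvPolynomial (Fin n) A) _ (MvPolynomial.monomial e α ^ m) =
      algebraMap (MvPolynomial (Fin n) A) _ (MvPolynomial.monomial d b) := by rw [← hf, hx]
  rw [awayCoeff_mul_pow hf u hx', ← intExponent_eq_add_iff.2 hd, AddMonoidAlgebra.coeff_single,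
    Finsupp.single_eq_same]

theorem eq_zero_of_mul_algebraMap_pow_eq_zero {α : A} {m : ℕ} {y : Localization.Away α}
    (h : y * algebraMap A _ (α ^ m) = 0) : y = 0 := by
  rw [map_pow] at h
  exact ((IsLocalization.Away.algebraMap_isUnit (S := Localization.Away α) α).pow m).mul_left_eq_zero.1 h

/-- The localization of a polynomial ring at `f` is spanned by fractions of terms. -/
theorem span_monomial_fractions (f : MvPolynomial (Fin n) A) :
    Submodule.span A {x : Localization.Away f | ∃ (m : ℕ) (d : Fin n →₀ ℕ) (b : A),
      x * algebraMap (MvPolynomial (Fin n) A) (Localization.Away f) (f ^ m) =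
        algebraMap (MvPolynomial (Fin n) A) (Localization.Away f)
          (MvPolynomial.monomial d b)} = ⊤ := by
  rw [eq_top_iff]
  rintro x -
  obtain ⟨⟨p, ⟨_, m, rfl⟩⟩, hx⟩ := IsLocalization.mk'_surjective (Submonoid.powers f) x
  subst hx
  induction p using MvPolynomial.induction_on' with
  | monomial d b =>
    exact Submodule.subset_span ⟨m, d, b, IsLocalization.mk'_spec _ _ _⟩
  | add p q hp hq =>
    change IsLocalization.mk' _ (p + q) _ ∈ _
    have hadd : IsLocalization.mk' (Localization.Away f) (p + q)
        (⟨f ^ m, m, rfl⟩ : Submonoid.powers f) =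
          IsLocalization.mk' _ p (⟨f ^ m, m, rfl⟩ : Submonoid.powers f) +
          IsLocalization.mk' _ q (⟨f ^ m, m, rfl⟩ : Submonoid.powers f) := by
      rw [IsLocalization.mk'_eq_iff_eq_mul, add_mul, IsLocalization.mk'_spec,
        IsLocalization.mk'_spec, map_add]
    rw [hadd]
    exact add_mem hp hq

/-- Taking coefficients commutes with the localization maps. -/
theorem awayCoeff_awayMap {f' : MvPolynomial (Fin n) A} {e' : Fin n →₀ ℕ} {α' : A}
    (hf : f = MvPolynomial.monomial e α) (hf' : f' = MvPolynomial.monomial e' α')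
    (h : f ∣ f') (hα : α ∣ α') (u : Fin n → ℤ) (x : Localization.Away f) :
    awayCoeff hf' u (awayMap h x) = awayMap hα (awayCoeff hf u x) := by
  have hle : (⊤ : Submodule A (Localization.Away f)) ≤
      LinearMap.eqLocus (awayCoeff hf' u ∘ₗ (awayMap h).toLinearMap.restrictScalars A)
        ((awayMap hα).toLinearMap ∘ₗ awayCoeff hf u) := by
    rw [← span_monomial_fractions f, Submodule.span_le]
    rintro x ⟨m, d, b, hx⟩
    change awayCoeff hf' u (awayMap h x) = awayMap hα (awayCoeff hf u x)
    have hx' : x * algebraMap (MvPolynomial (Fin n) A) _ (MvPolynomial.monomial e α ^ m) =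
      algebraMap (MvPolynomial (Fin n) A) _ (MvPolynomial.monomial d b) := by rw [← hf, hx]
    have h1 := congrArg (awayMap hα) (awayCoeff_mul_pow hf u hx')
    have hx'' := congrArg (awayMap h) hx'
    rw [map_mul, AlgHom.commutes, AlgHom.commutes] at hx''
    have h2 := awayCoeff_mul_pow hf' u hx''
    -- The old denominator divides a power of the new one, so equality may be tested after
    -- multiplying by it.
    have hunit : IsUnit (algebraMap A (Localization.Away α') (α ^ m)) := by
      refine isUnit_of_dvd_unit (map_dvd _ (pow_dvd_pow_of_dvd hα m)) ?_
      rw [map_pow]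
      exact (IsLocalization.Away.algebraMap_isUnit α').pow m
    refine hunit.mul_right_cancel ?_
    rw [h2, ← AlgHom.commutes (awayMap hα) (α ^ m), ← map_mul, awayCoeff_mul_pow hf u hx']
    rw [AddMonoidAlgebra.coeff_single, AddMonoidAlgebra.coeff_single]
    classical
    rw [Finsupp.single_apply, Finsupp.single_apply]
    split_ifs
    · rw [AlgHom.commutes]
    · rw [map_zero]
  exact hle (Submodule.mem_top (x := x))

theorem exists_of_mem_awayDegree (hf : f = MvPolynomial.monomial e α) {u : Fin n → ℤ}
    {x : Localization.Away f} (hx : x ∈ awayDegree f e u) :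
    x = 0 ∨ ∃ (m : ℕ) (d : Fin n →₀ ℕ) (b : A),
      (∀ k, (d k : ℤ) - m * e k = u k) ∧
      x * algebraMap (MvPolynomial (Fin n) A) (Localization.Away f) (f ^ m) =
        algebraMap (MvPolynomial (Fin n) A) (Localization.Away f) (MvPolynomial.monomial d b) := by
  induction hx using Submodule.span_induction with
  | mem x hx => exact Or.inr hx
  | zero => exact Or.inl rfl
  | smul a x _ hx =>
    rcases hx with rfl | ⟨m, d, b, hd, hx⟩
    · exact Or.inl (smul_zero a)
    · refine Or.inr ⟨m, d, a * b, hd, ?_⟩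
      rw [smul_mul_assoc, hx, ← smul_eq_mul, ← MvPolynomial.smul_monomial]
      exact (map_smul (IsScalarTower.toAlgHom A (MvPolynomial (Fin n) A) (Localization.Away f))
        a _).symm
  | add x y _ _ hx hy =>
    rcases hx with rfl | ⟨m, d, b, hd, hx⟩
    · rwa [zero_add]
    rcases hy with rfl | ⟨m', d', b', hd', hy⟩
    · rw [add_zero]
      exact Or.inr ⟨m, d, b, hd, hx⟩
    · refine Or.inr ⟨m + m', d + m' • e, b * α ^ m' + b' * α ^ m, fun k => ?_, ?_⟩
      · rw [← hd k]
        simp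
        ring
      · have hdd : d + m' • e = d' + m • e := by
          ext k
          have h := (hd k).trans (hd' k).symm
          simp only [Finsupp.add_apply, Finsupp.smul_apply, smul_eq_mul]
          zify
          linarith
        have h1 : MvPolynomial.monomial (d + m' • e) (b * α ^ m') =
            MvPolynomial.monomial d b * f ^ m' := by
          rw [hf, MvPolynomial.monomial_pow, MvPolynomial.monomial_mul]
        have h2 : MvPolynomial.monomial (d + m' • e) (b' * α ^ m) =
            MvPolynomial.monomial d' b' * f ^ m := by
          rw [hdd, hf, MvPolynomial.monomial_pow, MvPolynomial.monomial_mul]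
        rw [map_add (MvPolynomial.monomial (d + m' • e)), h1, h2, map_add, map_mul, map_mul, ← hx,
          ← hy, pow_add, map_mul]
        ring

/-- Injectivity of the coefficient map in degree `u`: if `α ^ k` kills the coefficient of the
numerator, then `f ^ k` kills the numerator. -/
theorem eq_zero_of_mem_awayDegree (hf : f = MvPolynomial.monomial e α) {u : Fin n → ℤ}
    {x : Localization.Away f} (hx : x ∈ awayDegree f e u) (h : awayCoeff hf u x = 0) : x = 0 := by
  rcases exists_of_mem_awayDegree hf hx with rfl | ⟨m, d, b, hd, hx⟩
  · rfl
  have hb : algebraMap A (Localization.Away α) b = 0 := by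
    rw [← awayCoeff_mul_pow_of_eq hf hd hx, h, zero_mul]
  obtain ⟨⟨_, k, rfl⟩, hk⟩ :=
    (IsLocalization.map_eq_zero_iff (Submonoid.powers α) (Localization.Away α) b).1 hb
  have hz : x * algebraMap (MvPolynomial (Fin n) A) (Localization.Away f) (f ^ (m + k)) = 0 := by
    rw [pow_add, map_mul, ← mul_assoc, hx, ← map_mul]
    have : MvPolynomial.monomial d b * f ^ k = 0 := by
      rw [hf, MvPolynomial.monomial_pow, MvPolynomial.monomial_mul, mul_comm b, hk,
        MvPolynomial.monomial_zero]
    rw [this, map_zero]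
  exact eq_zero_of_mul_algebraMap_pow_eq_zero hz

theorem exists_mem_awayDegree (hf : f = MvPolynomial.monomial e α) {u : Fin n → ℤ}
    (hu : ∀ k, e k = 0 → 0 ≤ u k) (y : Localization.Away α) :
    ∃ x ∈ awayDegree f e u, awayCoeff hf u x = y := by
  obtain ⟨⟨b, ⟨_, m, rfl⟩⟩, hy⟩ := IsLocalization.mk'_surjective (Submonoid.powers α) y
  have hy' : y * algebraMap A _ (α ^ m) = algebraMap A _ b := by
    rw [← hy]
    exact IsLocalization.mk'_spec _ _ _
  -- Enlarging the denominator exponent by `m'` makes `u k + (m + m') * e k` nonnegative wherever `e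
  -- k > 0`, so these are the exponents of a genuine monomial.
  let m' := ∑ k, (u k).natAbs
  have hpos : ∀ k, 0 ≤ u k + (m + m' : ℕ) * e k := fun k => by
    rcases Nat.eq_zero_or_pos (e k) with h | h
    · simpa [h] using hu k h
    · have h1 : (u k).natAbs ≤ m' := Finset.single_le_sum (f := fun k => (u k).natAbs)
        (fun _ _ => Nat.zero_le _) (Finset.mem_univ k)
      have h2 : m' ≤ (m + m') * e k := (Nat.le_add_left _ _).trans (Nat.le_mul_of_pos_right _ h)
      have h3 : (u k).natAbs ≤ (m + m') * e k := h1.trans h2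
      zify at h3
      push_cast
      have h4 := neg_abs_le (u k)
      linarith
  let d : Fin n →₀ ℕ := Finsupp.equivFunOnFinite.symm fun k => (u k + (m + m' : ℕ) * e k).toNat
  have hd : ∀ k, (d k : ℤ) - (m + m' : ℕ) * e k = u k := fun k => by
    change ((u k + (m + m' : ℕ) * e k).toNat : ℤ) - _ = _
    rw [Int.toNat_of_nonneg (hpos k)]
    ring
  let x : Localization.Away f := IsLocalization.mk' _ (MvPolynomial.monomial d (b * α ^ m'))
    (⟨f ^ (m + m'), m + m', rfl⟩ : Submonoid.powers f)
  have hx : x * algebraMap (MvPolynomial (Fin n) A) _ (f ^ (m + m')) =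
      algebraMap (MvPolynomial (Fin n) A) _ (MvPolynomial.monomial d (b * α ^ m')) :=
    IsLocalization.mk'_spec _ _ _
  refine ⟨x, Submodule.subset_span ⟨_, d, _, hd, hx⟩, ?_⟩
  rw [← sub_eq_zero]
  refine eq_zero_of_mul_algebraMap_pow_eq_zero (m := m + m') ?_
  rw [sub_mul, awayCoeff_mul_pow_of_eq hf hd hx, pow_add, map_mul, map_mul, ← mul_assoc, hy',
    sub_self]

/-- Inverting `α X^e` creates no negative exponents in a variable absent from `X^e`. -/
theorem awayCoeff_eq_zero (hf : f = MvPolynomial.monomial e α) {u : Fin n → ℤ}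
    (hu : ¬ ∀ k, e k = 0 → 0 ≤ u k) (x : Localization.Away f) : awayCoeff hf u x = 0 := by
  have hle : (⊤ : Submodule A (Localization.Away f)) ≤ LinearMap.ker (awayCoeff hf u) := by
    rw [← span_monomial_fractions f, Submodule.span_le]
    rintro x ⟨m, d, b, hx⟩
    have hx' : x * algebraMap (MvPolynomial (Fin n) A) _ (MvPolynomial.monomial e α ^ m) =
      algebraMap (MvPolynomial (Fin n) A) _ (MvPolynomial.monomial d b) := by rw [← hf, hx]
    refine eq_zero_of_mul_algebraMap_pow_eq_zero (m := m) ?_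
    rw [awayCoeff_mul_pow hf u hx', AddMonoidAlgebra.coeff_single, Finsupp.single_eq_of_ne']
    intro h
    refine hu fun k hk => ?_
    rw [← intExponent_eq_add_iff.1 h k, hk]
    simp
  exact hle (Submodule.mem_top (x := x))

theorem awayMap_mem_awayDegree {f' : MvPolynomial (Fin n) A} {e' : Fin n →₀ ℕ} {α' : A}
    (hf : f = MvPolynomial.monomial e α) (hf' : f' = MvPolynomial.monomial e' α')
    (h : f ∣ f') (hα : α ∣ α') (he : e ≤ e') {u : Fin n → ℤ} {x : Localization.Away f}
    (hx : x ∈ awayDegree f e u) : awayMap h x ∈ awayDegree f' e' u := by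
  rcases exists_of_mem_awayDegree hf hx with rfl | ⟨m, d, b, hd, hx⟩
  · rw [map_zero]
    exact Submodule.zero_mem _
  obtain ⟨γ, rfl⟩ := hα
  obtain ⟨e'', rfl⟩ := exists_add_of_le he
  -- With `f' = f * γ X^e''`, passing from denominator `f ^ m` to `f' ^ m` multiplies the numerator
  -- by `(γ X^e'') ^ m`.
  refine Submodule.subset_span ⟨m, d + m • e'', b * γ ^ m, fun k => ?_, ?_⟩
  · rw [← hd k]
    simp
    ring
  · have h1 : f' ^ m = f ^ m * MvPolynomial.monomial e'' γ ^ m := by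
      rw [← mul_pow, hf, hf', MvPolynomial.monomial_mul]
    have h2 := congrArg (awayMap h) hx
    rw [map_mul, AlgHom.commutes, AlgHom.commutes] at h2
    rw [h1, map_mul, ← mul_assoc, h2, ← map_mul, MvPolynomial.monomial_pow,
      MvPolynomial.monomial_mul]

end Laurent

/-! ### The homogeneous components of local cohomology -/

section CechDegree

theorem cechD_apply {R : Type*} [CommRing R] {c : ℕ} (f : Fin c → R) (k : ℕ)
    (x : CechCochain f k) (S : {S : Finset (Fin c) // S.card = k + 1}) :
    cechD f k x S = ∑ j : S.1, (-1 : R) ^ (S.1.filter (· < j.1)).card •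
      awayMap (Finset.prod_dvd_prod_of_subset _ _ f (Finset.erase_subset j.1 S.1))
        (x ⟨S.1.erase j.1, by rw [Finset.card_erase_of_mem j.2, S.2]; rfl⟩) := by
  simp [cechD]

/-- The Čech signs are scalars of the polynomial ring, whereas the coefficient and base change maps
are linear only over `A`. -/
theorem neg_one_pow_smul (A : Type*) {R M : Type*} [CommRing A] [CommRing R] [Algebra A R]
    [AddCommGroup M] [Module A M] [Module R M] [IsScalarTower A R M] (m : ℕ) (y : M) :
    (-1 : R) ^ m • y = (-1 : A) ^ m • y := by
  rw [← algebraMap_smul R ((-1 : A) ^ m), map_pow, map_neg, map_one]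

variable {A : Type*} [CommRing A] {n c : ℕ}

theorem prod_cMonomial (a : Fin c → A) (ξ : Fin c → Fin n →₀ ℕ) (S : Finset (Fin c)) :
    ∏ j ∈ S, cMonomial a ξ j = MvPolynomial.monomial (∑ j ∈ S, ξ j) (∏ j ∈ S, a j) :=
  (MvPolynomial.monomial_sum_prod S ξ a).symm

/-- The cochains that are supported on a given set of simplices. -/
noncomputable def cechRestrict (a : Fin c → A) (Δ : Finset (Fin c) → Prop) (k : ℕ) :
    CechCochain a k →ₗ[A] CechCochain a k := by
  classical
  exact LinearMap.pi fun S => if Δ S.1 then LinearMap.proj S else 0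

theorem cechRestrict_apply_of_pos (a : Fin c → A) {Δ : Finset (Fin c) → Prop} {k : ℕ}
    (x : CechCochain a k) {S : {S : Finset (Fin c) // S.card = k}} (hS : Δ S.1) :
    cechRestrict a Δ k x S = x S := by
  simp [cechRestrict, hS]

theorem cechRestrict_apply_of_neg (a : Fin c → A) {Δ : Finset (Fin c) → Prop} {k : ℕ}
    (x : CechCochain a k) {S : {S : Finset (Fin c) // S.card = k}} (hS : ¬ Δ S.1) :
    cechRestrict a Δ k x S = 0 := by
  simp [cechRestrict, hS]

/-- The differential into degree `i` of the subcomplex of cochains supported on `Δ`. -/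
noncomputable def supportedPrev (a : Fin c → A) (Δ : Finset (Fin c) → Prop) :
    (i : ℕ) → CechCochain a (i - 1) →ₗ[A] CechCochain a i
  -- In degree `0` the source index `i - 1` truncates to `0`; the zero map makes its image match the
  -- zero coboundaries.
  | 0 => 0
  | i + 1 => cechD a i ∘ₗ cechRestrict a Δ i

/-- A map whose kernel consists of the cocycles supported on `Δ`. -/
noncomputable def supportedNext (a : Fin c → A) (Δ : Finset (Fin c) → Prop) (i : ℕ) :
    CechCochain a i →ₗ[A] CechCochain a (i + 1) × CechCochain a i :=
  -- The second component imposes the support condition as an equation, so the cochain modules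
  -- remain full products of localizations.
  (cechD a i).prod (cechRestrict a (fun S => ¬ Δ S) i)

/-- The cohomology of the subcomplex of cochains supported on `Δ` of the Čech complex of `A`. -/
abbrev SupportedCohomology (a : Fin c → A) (Δ : Finset (Fin c) → Prop) (i : ℕ) : Type _ :=
  LinearHomology (supportedPrev a Δ i) (supportedNext a Δ i)

variable (a : Fin c → A) (ξ : Fin c → Fin n →₀ ℕ) (u : Fin n → ℤ)

/-- The sets `S` for which the localization at `∏_{j ∈ S} a_j X^{ξ_j}` can be nonzero in
degree `u`. -/
def DegreeSupport (S : Finset (Fin c)) : Prop :=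
  ∀ k, (∑ j ∈ S, ξ j) k = 0 → 0 ≤ u k

/-- Taking the coefficient of `Xᵘ` on Čech cochains. -/
noncomputable def cechCoeff (k : ℕ) : CechCochain (cMonomial a ξ) k →ₗ[A] CechCochain a k :=
  LinearMap.pi fun S => awayCoeff (prod_cMonomial a ξ S.1) u ∘ₗ LinearMap.proj S

theorem cechCoeff_apply (k : ℕ) (x : CechCochain (cMonomial a ξ) k)
    (S : {S : Finset (Fin c) // S.card = k}) :
    cechCoeff a ξ u k x S = awayCoeff (prod_cMonomial a ξ S.1) u (x S) := rfl

theorem cechCoeff_cechD (k : ℕ) (x : CechCochain (cMonomial a ξ) k) :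
    cechCoeff a ξ u (k + 1) (cechD _ k x) = cechD a k (cechCoeff a ξ u k x) := by
  ext S
  rw [cechCoeff_apply, cechD_apply, cechD_apply, map_sum]
  refine Finset.sum_congr rfl fun j _ => ?_
  rw [neg_one_pow_smul A, map_smul, awayCoeff_awayMap (prod_cMonomial a ξ _) _ _
    (Finset.prod_dvd_prod_of_subset _ _ a (Finset.erase_subset j.1 S.1))]
  rfl

theorem mem_cechDegree_iff {k : ℕ} {x : CechCochain (cMonomial a ξ) k} :
    x ∈ cechDegree a ξ k u ↔
      ∀ S, x S ∈ awayDegree (∏ j ∈ S.1, cMonomial a ξ j) (∑ j ∈ S.1, ξ j) u :=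
  ⟨fun h S => h S trivial, fun h S _ => h S⟩

theorem cechD_mem_cechDegree (k : ℕ) {x : CechCochain (cMonomial a ξ) k}
    (hx : x ∈ cechDegree a ξ k u) : cechD _ k x ∈ cechDegree a ξ (k + 1) u := by
  rw [mem_cechDegree_iff] at hx ⊢
  intro S
  rw [cechD_apply]
  refine Submodule.sum_mem _ fun j _ => ?_
  have hj := awayMap_mem_awayDegree (prod_cMonomial a ξ (S.1.erase j.1))
    (prod_cMonomial a ξ S.1)
    (Finset.prod_dvd_prod_of_subset _ _ (cMonomial a ξ) (Finset.erase_subset j.1 S.1))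
    (Finset.prod_dvd_prod_of_subset _ _ a (Finset.erase_subset j.1 S.1))
    (Finset.sum_le_sum_of_subset (Finset.erase_subset j.1 S.1))
    (hx ⟨S.1.erase j.1, by rw [Finset.card_erase_of_mem j.2, S.2]; rfl⟩)
  rw [neg_one_pow_smul A]
  exact Submodule.smul_mem _ _ hj

theorem eq_zero_of_mem_cechDegree {k : ℕ} {x : CechCochain (cMonomial a ξ) k}
    (hx : x ∈ cechDegree a ξ k u) (h : cechCoeff a ξ u k x = 0) : x = 0 := by
  ext S
  exact eq_zero_of_mem_awayDegree (prod_cMonomial a ξ S.1) ((mem_cechDegree_iff a ξ u).1 hx S)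
    (congrFun h S)

theorem cechCoeff_eq_zero_of_not_degreeSupport {k : ℕ} (x : CechCochain (cMonomial a ξ) k)
    {S : {S : Finset (Fin c) // S.card = k}} (hS : ¬ DegreeSupport ξ u S.1) :
    cechCoeff a ξ u k x S = 0 :=
  awayCoeff_eq_zero (prod_cMonomial a ξ S.1) hS (x S)

theorem cechRestrict_cechCoeff {k : ℕ} (x : CechCochain (cMonomial a ξ) k) :
    cechRestrict a (DegreeSupport ξ u) k (cechCoeff a ξ u k x) = cechCoeff a ξ u k x := by
  ext S
  by_cases hS : DegreeSupport ξ u S.1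
  · rw [cechRestrict_apply_of_pos _ _ hS]
  · rw [cechRestrict_apply_of_neg _ _ hS, cechCoeff_eq_zero_of_not_degreeSupport a ξ u x hS]

theorem cechRestrict_not_cechCoeff {k : ℕ} (x : CechCochain (cMonomial a ξ) k) :
    cechRestrict a (fun S => ¬ DegreeSupport ξ u S) k (cechCoeff a ξ u k x) = 0 := by
  ext S
  by_cases hS : DegreeSupport ξ u S.1
  · rw [cechRestrict_apply_of_neg _ _ (not_not.2 hS)]
    rfl
  · rw [cechRestrict_apply_of_pos _ _ hS, cechCoeff_eq_zero_of_not_degreeSupport a ξ u x hS]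
    rfl

theorem exists_mem_cechDegree {k : ℕ} (y : CechCochain a k) :
    ∃ x ∈ cechDegree a ξ k u,
      cechCoeff a ξ u k x = cechRestrict a (DegreeSupport ξ u) k y := by
  have h : ∀ S : {S : Finset (Fin c) // S.card = k},
      ∃ x ∈ awayDegree (∏ j ∈ S.1, cMonomial a ξ j) (∑ j ∈ S.1, ξ j) u,
        awayCoeff (prod_cMonomial a ξ S.1) u x =
          cechRestrict a (DegreeSupport ξ u) k y S := fun S => by
    by_cases hS : DegreeSupport ξ u S.1
    · exact exists_mem_awayDegree _ hS _
    · exact ⟨0, Submodule.zero_mem _, by rw [cechRestrict_apply_of_neg _ _ hS, map_zero]⟩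
  choose x hx hxy using h
  exact ⟨x, (mem_cechDegree_iff a ξ u).2 hx, funext hxy⟩

theorem cechRestrict_eq_self_of_mem_ker {Δ : Finset (Fin c) → Prop} {i : ℕ} {y : CechCochain a i}
    (hy : y ∈ LinearMap.ker (supportedNext a Δ i)) : cechRestrict a Δ i y = y := by
  have h : cechRestrict a (fun S => ¬ Δ S) i y = 0 := congrArg Prod.snd (LinearMap.mem_ker.1 hy)
  ext S
  by_cases hS : Δ S.1
  · rw [cechRestrict_apply_of_pos _ _ hS]
  · rw [cechRestrict_apply_of_neg _ _ hS, ← cechRestrict_apply_of_pos a y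
      (Δ := fun S => ¬ Δ S) hS, h]
    rfl

/-- A homogeneous cocycle is a coboundary if and only if its coefficient is. -/
theorem mem_cechCoboundaries_iff {i : ℕ} {x : CechCochain (cMonomial a ξ) i}
    (hx : x ∈ cechDegree a ξ i u) : x ∈ cechCoboundaries (cMonomial a ξ) i ↔
      cechCoeff a ξ u i x ∈ LinearMap.range (supportedPrev a (DegreeSupport ξ u) i) := by
  cases i with
  | zero =>
    constructor
    · intro h
      have h0 : x = 0 := h
      rw [h0, map_zero]
      exact Submodule.zero_mem _
    · rintro ⟨y, hy⟩
      exact eq_zero_of_mem_cechDegree a ξ u hx hy.symm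
  | succ i =>
    constructor
    -- The primitive `w` need not be homogeneous; its coefficient in degree `u` is a primitive of
    -- the coefficient, automatically supported where it should be.
    · rintro ⟨w, rfl⟩
      refine ⟨cechCoeff a ξ u i w, ?_⟩
      rw [cechCoeff_cechD]
      exact congrArg (cechD a i) (cechRestrict_cechCoeff a ξ u w)
    · rintro ⟨v, hv⟩
      obtain ⟨w, hw, hwv⟩ := exists_mem_cechDegree a ξ u (k := i) v
      refine ⟨w, ?_⟩
      symm
      rw [← sub_eq_zero]
      refine eq_zero_of_mem_cechDegree a ξ u
        (Submodule.sub_mem _ hx (cechD_mem_cechDegree a ξ u i hw)) ?_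
      rw [map_sub, cechCoeff_cechD, hwv, ← hv]
      exact sub_self _

/-- The component of degree `u` of local cohomology is the cohomology of a subcomplex of a Čech
complex of the base ring. -/
theorem nonempty_localCohomologyDegree_equiv (i : ℕ) :
    Nonempty (localCohomologyDegree a ξ i u ≃ₗ[A]
      SupportedCohomology a (DegreeSupport ξ u) i) := by
  let N : Submodule A (cechCocycles (cMonomial a ξ) i) := (cechDegree a ξ i u).comap
    ((cechCocycles (cMonomial a ξ) i).subtype.restrictScalars A)
  let Q := (cechCoboundaries (cMonomial a ξ) i).submoduleOf (cechCocycles (cMonomial a ξ) i)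
  let Ψ : N →ₗ[A] localCohomologyDegree a ξ i u := (Q.mkQ.restrictScalars A).submoduleMap N
  let κ : N →ₗ[A] CechCochain a i := cechCoeff a ξ u i ∘ₗ
    (cechCocycles (cMonomial a ξ) i).subtype.restrictScalars A ∘ₗ N.subtype
  have hκ : ∀ z, κ z = cechCoeff a ξ u i z.1.1 := fun z => rfl
  let κ' : N →ₗ[A] LinearMap.ker (supportedNext a (DegreeSupport ξ u) i) :=
    κ.codRestrict _ fun z => by
      refine Prod.ext ?_ (cechRestrict_not_cechCoeff a ξ u z.1.1)
      change cechD a i (cechCoeff a ξ u i z.1.1) = 0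
      rw [← cechCoeff_cechD, LinearMap.mem_ker.1 z.1.2, map_zero]
  let W := (LinearMap.range (supportedPrev a (DegreeSupport ξ u) i)).submoduleOf
    (LinearMap.ker (supportedNext a (DegreeSupport ξ u) i))
  have hΨ : Function.Surjective Ψ := LinearMap.submoduleMap_surjective _ N
  refine LinearMap.nonempty_equiv_of_surjective_of_ker_eq (R := A) (M := N)
    (P := localCohomologyDegree a ξ i u) Ψ (W.mkQ ∘ₗ κ') hΨ
    ((Submodule.mkQ_surjective _).comp ?_) ?_
  · rintro ⟨y, hy⟩
    -- A supported cocycle lifts to a homogeneous cochain; the differential of the lift is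
    -- homogeneous with zero coefficient, hence zero.
    obtain ⟨x, hx, hxy⟩ := exists_mem_cechDegree a ξ u y
    rw [cechRestrict_eq_self_of_mem_ker a hy] at hxy
    have hdx : cechD _ i x = 0 := by
      refine eq_zero_of_mem_cechDegree a ξ u (cechD_mem_cechDegree a ξ u i hx) ?_
      rw [cechCoeff_cechD, hxy]
      exact congrArg Prod.fst (LinearMap.mem_ker.1 hy)
    exact ⟨⟨⟨x, hdx⟩, hx⟩, Subtype.ext hxy⟩
  · ext z
    have h1 : z ∈ LinearMap.ker Ψ ↔ z.1.1 ∈ cechCoboundaries (cMonomial a ξ) i := by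
      rw [LinearMap.mem_ker, Subtype.ext_iff]
      exact Submodule.Quotient.mk_eq_zero Q
    have h2 : z ∈ LinearMap.ker (W.mkQ ∘ₗ κ') ↔
        κ z ∈ LinearMap.range (supportedPrev a (DegreeSupport ξ u) i) :=
      Submodule.Quotient.mk_eq_zero W
    rw [h1, h2, hκ]
    exact mem_cechCoboundaries_iff a ξ u z.2

end CechDegree

/-! ### Base change of the cohomology of supported cochains -/

section BaseChange

variable {A B : Type*} [CommRing A] [CommRing B] [Algebra A B] {c : ℕ}

/-- The map `A_α → B_{α'}` if `α'` is the image of `α`. -/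
noncomputable def awayBaseChange {α : A} {α' : B} (h : algebraMap A B α = α') :
    Localization.Away α →ₐ[A] Localization.Away α' :=
  IsLocalization.liftAlgHom (M := Submonoid.powers α)
    (f := Algebra.ofId A (Localization.Away α')) (by
      rintro ⟨_, m, rfl⟩
      rw [map_pow, Algebra.ofId_apply, IsScalarTower.algebraMap_apply A B, h]
      exact (IsLocalization.Away.algebraMap_isUnit α').pow m)

/-- Localization commutes with base change: `B_α'` is the localization of `B` at the image of the
powers of `α`, which gives a pushout square. -/
theorem isBaseChange_awayBaseChange {α : A} {α' : B} (h : algebraMap A B α = α') :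
    IsBaseChange B (awayBaseChange h).toLinearMap := by
  let _ : Algebra (Localization.Away α) (Localization.Away α') :=
    (awayBaseChange h).toRingHom.toAlgebra
  have : IsScalarTower A (Localization.Away α) (Localization.Away α') :=
    IsScalarTower.of_algebraMap_eq fun x => ((awayBaseChange h).commutes x).symm
  have hloc : IsLocalization (Algebra.algebraMapSubmonoid B (Submonoid.powers α))
      (Localization.Away α') := by
    rw [Algebra.algebraMapSubmonoid_powers, h]
    infer_instance
  have := Algebra.isPushout_of_isLocalization (Submonoid.powers α) (Localization.Away α) B
    (Localization.Away α')
  exact (Algebra.IsPushout.out (R := A) (S := B) (R' := Localization.Away α)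
    (S' := Localization.Away α'))

theorem awayBaseChange_awayMap {α β : A} {α' β' : B} (hα : algebraMap A B α = α')
    (hβ : algebraMap A B β = β') (h : α ∣ β) (h' : α' ∣ β') (x : Localization.Away α) :
    awayBaseChange hβ (awayMap h x) = awayMap h' (awayBaseChange hα x) := by
  have : (awayBaseChange hβ).comp (awayMap h) =
      ((awayMap h').restrictScalars A).comp (awayBaseChange hα) :=
    IsLocalization.algHom_ext (Submonoid.powers α) (Subsingleton.elim _ _)
  exact DFunLike.congr_fun this x

/-- The base change map on Čech cochains. -/
noncomputable def cechBaseChange (B : Type*) [CommRing B] [Algebra A B] (a : Fin c → A) (k : ℕ) :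
    CechCochain a k →ₗ[A] CechCochain (fun j => algebraMap A B (a j)) k :=
  LinearMap.pi fun S => (awayBaseChange (map_prod (algebraMap A B) a S.1)).toLinearMap ∘ₗ
    LinearMap.proj S

theorem cechBaseChange_apply (a : Fin c → A) (k : ℕ) (x : CechCochain a k)
    (S : {S : Finset (Fin c) // S.card = k}) :
    cechBaseChange B a k x S = awayBaseChange (map_prod (algebraMap A B) a S.1) (x S) := rfl

theorem isBaseChange_cechBaseChange (a : Fin c → A) (k : ℕ) :
    IsBaseChange B (cechBaseChange B a k) :=
  IsBaseChange.pi _ fun _ => isBaseChange_awayBaseChange _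

theorem cechD_cechBaseChange (a : Fin c → A) (k : ℕ) (x : CechCochain a k) :
    cechD _ k (cechBaseChange B a k x) = cechBaseChange B a (k + 1) (cechD a k x) := by
  ext S
  rw [cechBaseChange_apply, cechD_apply, cechD_apply, map_sum]
  refine Finset.sum_congr rfl fun j _ => ?_
  rw [neg_one_pow_smul A, map_smul, awayBaseChange_awayMap (map_prod (algebraMap A B) a _)]
  rfl

theorem cechRestrict_cechBaseChange (a : Fin c → A) (Δ : Finset (Fin c) → Prop) (k : ℕ)
    (x : CechCochain a k) :
    cechRestrict _ Δ k (cechBaseChange B a k x) = cechBaseChange B a k (cechRestrict a Δ k x) := by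
  ext S
  rw [cechBaseChange_apply]
  by_cases hS : Δ S.1
  · rw [cechRestrict_apply_of_pos _ _ hS, cechRestrict_apply_of_pos _ _ hS]
    rfl
  · rw [cechRestrict_apply_of_neg _ _ hS, cechRestrict_apply_of_neg _ _ hS, map_zero]

/-- The cohomology of supported cochains commutes with flat base change. -/
theorem SupportedCohomology.nonempty_baseChange_equiv [Module.Flat A B] (a : Fin c → A)
    (Δ : Finset (Fin c) → Prop) (i : ℕ) :
    Nonempty ((B ⊗[A] SupportedCohomology a Δ i) ≃ₗ[B]
      SupportedCohomology (fun j => algebraMap A B (a j)) Δ i) := by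
  refine LinearHomology.nonempty_baseChange_equiv (isBaseChange_cechBaseChange a (i - 1))
    (isBaseChange_cechBaseChange a i) (IsBaseChange.prodMap _ _
      (isBaseChange_cechBaseChange a (i + 1)) (isBaseChange_cechBaseChange a i))
    (fun x => ?_) (fun y => ?_)
  · cases i with
    | zero => exact (map_zero _).symm
    | succ i =>
      exact (congrArg (cechD _ i) (cechRestrict_cechBaseChange a Δ i x)).trans
        (cechD_cechBaseChange a i _)
  · exact Prod.ext (cechD_cechBaseChange a i y)
      (cechRestrict_cechBaseChange a (fun S => ¬ Δ S) i y)

/-- The components of local cohomology commute with flat base change. -/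
theorem nonempty_localCohomologyDegree_baseChange_equiv [Module.Flat A B] {n : ℕ} (a : Fin c → A)
    (ξ : Fin c → Fin n →₀ ℕ) (i : ℕ) (u : Fin n → ℤ) :
    Nonempty ((B ⊗[A] localCohomologyDegree a ξ i u) ≃ₗ[B]
      localCohomologyDegree (fun j => algebraMap A B (a j)) ξ i u) := by
  obtain ⟨e₁⟩ := nonempty_localCohomologyDegree_equiv a ξ u i
  obtain ⟨e₂⟩ := SupportedCohomology.nonempty_baseChange_equiv (B := B) a (DegreeSupport ξ u) i
  obtain ⟨e₃⟩ := nonempty_localCohomologyDegree_equiv (fun j => algebraMap A B (a j)) ξ u i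
  exact ⟨e₁.baseChange A B _ _ ≪≫ₗ e₂ ≪≫ₗ e₃.symm⟩

end BaseChange

/-! ### Local cohomology over a discrete valuation ring -/

section Structure

variable {B : Type*} [CommRing B] [IsDomain B] [IsDiscreteValuationRing B] (K : Type*) [Field K]
  [Algebra B K] [IsFractionRing B K]

/-- A trichotomy: `B_α` is `0` if `α = 0`, is `B` if `α` is a unit, and is `K` otherwise, as a
uniformizer then divides `α`. The product `B × K` covers all cases uniformly. -/
theorem Localization.Away.exists_surjective_and_injective (α : B) :
    (∃ F : B × K →ₗ[B] Localization.Away α, Function.Surjective F) ∧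
      ∃ e : Localization.Away α →ₗ[B] K, Function.Injective e := by
  by_cases hα : α = 0
  · have : Subsingleton (Localization.Away α) :=
      IsLocalization.subsingleton (M := Submonoid.powers α) ⟨1, by simpa using hα⟩
    exact ⟨⟨0, fun y => ⟨0, Subsingleton.elim _ _⟩⟩, ⟨0, fun x y _ => Subsingleton.elim _ _⟩⟩
  have hαK : algebraMap B K α ≠ 0 := by simpa using hα
  let e : Localization.Away α →ₐ[B] K := IsLocalization.liftAlgHom (M := Submonoid.powers α)
    (f := Algebra.ofId B K) (by
      rintro ⟨_, m, rfl⟩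
      rw [map_pow]
      exact (isUnit_iff_ne_zero.2 hαK).pow m)
  have he : Function.Injective e := by
    rw [injective_iff_map_eq_zero]
    intro x hx
    obtain ⟨⟨b, s⟩, rfl⟩ := IsLocalization.mk'_surjective (Submonoid.powers α) x
    have h := congrArg e (IsLocalization.mk'_spec (Localization.Away α) b s)
    rw [map_mul] at h
    change e (IsLocalization.mk' _ b s) = 0 at hx
    rw [hx, zero_mul, AlgHom.commutes, eq_comm, map_eq_zero_iff _
      (FaithfulSMul.algebraMap_injective B K)] at h
    change IsLocalization.mk' _ b s = 0
    rw [h, IsLocalization.mk'_zero]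
  refine ⟨?_, e.toLinearMap, he⟩
  by_cases hu : IsUnit α
  · refine ⟨Algebra.linearMap B _ ∘ₗ LinearMap.fst B B K, fun y => ?_⟩
    obtain ⟨⟨b, s⟩, rfl⟩ := IsLocalization.mk'_surjective (Submonoid.powers α) y
    have hs : IsUnit (s : B) := by
      obtain ⟨_, m, rfl⟩ := s
      exact hu.pow m
    obtain ⟨r, hr⟩ := isUnit_iff_exists_inv.1 hs
    refine ⟨(b * r, 0), ?_⟩
    change algebraMap B _ (b * r) = IsLocalization.mk' _ b s
    rw [eq_comm, IsLocalization.mk'_eq_iff_eq_mul, ← map_mul, mul_assoc, mul_comm r, hr, mul_one]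
  · have hes : Function.Surjective e := fun k => by
      obtain ⟨x, b, hb, rfl⟩ := IsFractionRing.div_surjective (A := B) k
      have hb0 : b ≠ 0 := nonZeroDivisors.ne_zero hb
      have hbK : algebraMap B K b ≠ 0 := by simpa using hb0
      obtain ⟨ϖ, hϖ⟩ := IsDiscreteValuationRing.exists_irreducible B
      obtain ⟨m, hm⟩ := IsDiscreteValuationRing.associated_pow_irreducible hb0 hϖ
      have hϖα : ϖ ∣ α := by
        rw [← Ideal.mem_span_singleton,
          ← (IsDiscreteValuationRing.irreducible_iff_uniformizer _).1 hϖ]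
        exact hu
      -- Since `b` divides `ϖ ^ m`, which divides `α ^ m = b * r`, the fraction `x / b` equals `x *
      -- r / α ^ m`.
      obtain ⟨r, hr⟩ := hm.dvd.trans (pow_dvd_pow_of_dvd hϖα m)
      refine ⟨IsLocalization.mk' _ (x * r) (⟨α ^ m, m, rfl⟩ : Submonoid.powers α), ?_⟩
      have h := congrArg e (IsLocalization.mk'_spec (Localization.Away α) (x * r)
        (⟨α ^ m, m, rfl⟩ : Submonoid.powers α))
      rw [map_mul, AlgHom.commutes, AlgHom.commutes] at h
      have hαm : algebraMap B K (α ^ m) ≠ 0 := by rw [map_pow]; exact pow_ne_zero m hαK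
      rw [eq_div_iff hbK]
      refine mul_right_cancel₀ hαm ?_
      rw [mul_right_comm]
      refine (congrArg (· * algebraMap B K b) h).trans ?_
      rw [← map_mul, ← map_mul, hr]
      congr 1
      ring
    let ε := LinearEquiv.ofBijective e.toLinearMap ⟨he, hes⟩
    exact ⟨ε.symm.toLinearMap ∘ₗ LinearMap.snd B B K, ε.symm.surjective.comp Prod.snd_surjective⟩

/-- Čech cochains are quotients of `Bᵐ × Kᵐ` and embed into `Kᵐ`. -/
theorem CechCochain.exists_surjective_and_injective {c : ℕ} (a : Fin c → B) (k : ℕ) :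
    (∃ F : ({S : Finset (Fin c) // S.card = k} → B) × ({S : Finset (Fin c) // S.card = k} → K)
        →ₗ[B] CechCochain a k, Function.Surjective F) ∧
      ∃ e : CechCochain a k →ₗ[B] ({S : Finset (Fin c) // S.card = k} → K),
        Function.Injective e := by
  choose F hF using fun S : {S : Finset (Fin c) // S.card = k} =>
    (Localization.Away.exists_surjective_and_injective K (∏ j ∈ S.1, a j)).1
  choose e he using fun S : {S : Finset (Fin c) // S.card = k} =>
    (Localization.Away.exists_surjective_and_injective K (∏ j ∈ S.1, a j)).2
  let ι := {S : Finset (Fin c) // S.card = k}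
  let F' : (ι → B) × (ι → K) →ₗ[B] CechCochain a k := LinearMap.pi fun S => F S ∘ₗ
    LinearMap.prodMap (LinearMap.proj S) (LinearMap.proj S)
  let e' : CechCochain a k →ₗ[B] (ι → K) := LinearMap.pi fun S => e S ∘ₗ LinearMap.proj S
  refine ⟨⟨F', fun y => ?_⟩, ⟨e', fun x y hxy => ?_⟩⟩
  · choose z hz using fun S => hF S (y S)
    exact ⟨(fun S => (z S).1, fun S => (z S).2), funext hz⟩
  · exact funext fun S => he S (congrFun hxy S)

/-- The structure of the components of local cohomology over a discrete valuation ring. -/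
theorem localCohomologyDegree.exists_equiv {n c : ℕ} (a : Fin c → B) (ξ : Fin c → Fin n →₀ ℕ)
    (i : ℕ) (u : Fin n → ℤ) :
    ∃ (l s r t : ℕ) (β : Fin t → ℕ), Nonempty (localCohomologyDegree a ξ i u ≃ₗ[B]
      ((Fin l → FractionQuotient B K) × (Fin s → K)) ×
        ((Fin r → B) × (∀ j : Fin t, B ⧸ IsLocalRing.maximalIdeal B ^ β j))) := by
  obtain ⟨e₀⟩ := nonempty_localCohomologyDegree_equiv a ξ u i
  obtain ⟨⟨FX, hFX⟩, -⟩ := CechCochain.exists_surjective_and_injective K a (i - 1)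
  obtain ⟨⟨FY, hFY⟩, eY, heY⟩ := CechCochain.exists_surjective_and_injective K a i
  obtain ⟨-, eZ, heZ⟩ := CechCochain.exists_surjective_and_injective K a (i + 1)
  obtain ⟨l, s, r, t, β, ⟨e⟩⟩ := LinearHomology.exists_equiv
    (f := supportedPrev a (DegreeSupport ξ u) i) (g := supportedNext a (DegreeSupport ξ u) i)
    FX hFX FY hFY eY heY
    ((LinearEquiv.sumArrowLequivProdArrow _ _ B K).symm.toLinearMap ∘ₗ eZ.prodMap eY)
    ((LinearEquiv.sumArrowLequivProdArrow _ _ B K).symm.injective.comp (heZ.prodMap heY))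
  exact ⟨l, s, r, t, β, ⟨e₀ ≪≫ₗ e⟩⟩

end Structure

/-- The torsion-free quotient of a component of local cohomology, after a flat base change to a
discrete valuation ring. -/
theorem localCohomologyDegree.exists_quotient_gammaTorsion_equiv {A T : Type*} [CommRing A]
    [CommRing T] [IsDomain T] [IsDiscreteValuationRing T] [Algebra A T] [Module.Flat A T]
    {q : Ideal A} (hq : q.map (algebraMap A T) = IsLocalRing.maximalIdeal T)
    {n c : ℕ} (a : Fin c → A) (ξ : Fin c → Fin n →₀ ℕ) (i : ℕ) (u : Fin n → ℤ) :
    ∃ r s : ℕ, Nonempty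
      (((T ⊗[A] localCohomologyDegree a ξ i u) ⧸
          gammaTorsion (q.map (algebraMap A T)) (T ⊗[A] localCohomologyDegree a ξ i u))
        ≃ₗ[T] (Fin r → T) × (Fin s → FractionRing T)) := by
  obtain ⟨e₂⟩ := nonempty_localCohomologyDegree_baseChange_equiv (B := T) a ξ i u
  obtain ⟨l, s, r, t, β, ⟨e₃⟩⟩ := localCohomologyDegree.exists_equiv (FractionRing T)
    (fun j => algebraMap A T (a j)) ξ i u
  rw [hq]
  exact ⟨r, s, nonempty_quotient_gammaTorsion_equiv (e₂ ≪≫ₗ e₃)⟩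

/-! ### Torsion and torsion-free quotients over the Dedekind domain -/

theorem theorem2p6 {A : Type*} [CommRing A] [IsDedekindDomain A]
    (hA : ∀ (p : Ideal A) [p.IsPrime], p ≠ ⊥ →
      IsMixedChar (Localization.AtPrime p) ∧
        Finite (IsLocalRing.ResidueField (Localization.AtPrime p)))
    {n c : ℕ} (a : Fin c → A) (ξ : Fin c → Fin n →₀ ℕ)
    (i : ℕ) (u : Fin n → ℤ) :
    (∀ p ∈ associatedPrimes A (LocalCohomologyModule (cMonomial a ξ) i), p ≠ ⊥ →
      ∃ (l t : ℕ) (β : Fin t → ℕ), Nonempty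
        (gammaTorsion p (localCohomologyDegree a ξ i u) ≃ₗ[A]
          (Fin l → InjectiveHull A (A ⧸ p)) × (∀ j : Fin t, A ⧸ p ^ β j))) ∧
    (∀ (q : Ideal A) [q.IsPrime], q ≠ ⊥ →
      Nonempty
        ((CompletedLocalization q ⊗[A] localCohomologyDegree a ξ i u) ≃ₗ[CompletedLocalization q]
          localCohomologyDegree (fun j => algebraMap A (CompletedLocalization q) (a j)) ξ i u) ∧
      ∃ r s : ℕ, Nonempty
        (((CompletedLocalization q ⊗[A] localCohomologyDegree a ξ i u) ⧸
            gammaTorsion (q.map (algebraMap A (CompletedLocalization q)))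
              (CompletedLocalization q ⊗[A] localCohomologyDegree a ξ i u))
          ≃ₗ[CompletedLocalization q]
          (Fin r → CompletedLocalization q) ×
            (Fin s → FractionRing (CompletedLocalization q)))) := by
  constructor
  · intro p hpass hp
    have hprime : p.IsPrime := hpass.isPrime
    have hmax : p.IsMaximal := hprime.isMaximal hp
    have : IsDiscreteValuationRing (Localization.AtPrime p) :=
      IsLocalization.AtPrime.isDiscreteValuationRing_of_dedekind_domain A hp _
    have : Module.Flat A (Localization.AtPrime p) := IsLocalization.flat _ p.primeCompl
    obtain ⟨e₁⟩ := nonempty_gammaTorsion_localization_equiv (B := Localization.AtPrime p) p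
      (IsNoetherian.noetherian p)
      (TensorProduct.mk A (Localization.AtPrime p) (localCohomologyDegree a ξ i u) 1)
    obtain ⟨e₂⟩ := nonempty_localCohomologyDegree_baseChange_equiv
      (B := Localization.AtPrime p) a ξ i u
    -- `FractionRing A` is also a fraction field of `A_p`, so its quotient by `A_p` is the model of
    -- the injective hull used below.
    obtain ⟨l, s, r, t, β, ⟨e₃⟩⟩ := localCohomologyDegree.exists_equiv
      (FractionRing A)
      (fun j => algebraMap A (Localization.AtPrime p) (a j)) ξ i u
    obtain ⟨e₄⟩ := nonempty_gammaTorsion_equiv (e₂ ≪≫ₗ e₃)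
    obtain ⟨e₅⟩ := nonempty_fractionQuotient_equiv_injectiveHull
      (B := Localization.AtPrime p) (K := FractionRing A) p
    exact ⟨l, t, β, ⟨e₁ ≪≫ₗ e₄.restrictScalars A ≪≫ₗ
      (LinearEquiv.piCongrRight fun _ => e₅).prodCongr (LinearEquiv.piCongrRight fun j =>
        (IsLocalization.AtPrime.equivQuotMaximalIdealPow p
          (Localization.AtPrime p) (β j)).symm.toLinearEquiv)⟩⟩
  · intro q hprime hq
    have : IsDiscreteValuationRing (Localization.AtPrime q) :=
      IsLocalization.AtPrime.isDiscreteValuationRing_of_dedekind_domain A hq _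
    have : Module.Flat A (Localization.AtPrime q) := IsLocalization.flat _ q.primeCompl
    -- Localization is flat, and so is completion of a Noetherian ring.
    have : Module.Flat A (CompletedLocalization q) :=
      Module.Flat.trans A (Localization.AtPrime q) (CompletedLocalization q)
    have hmap : q.map (algebraMap A (CompletedLocalization q)) =
        IsLocalRing.maximalIdeal (CompletedLocalization q) := by
      rw [IsScalarTower.algebraMap_eq A (Localization.AtPrime q) (CompletedLocalization q),
        ← Ideal.map_map, IsLocalization.AtPrime.map_eq_maximalIdeal q (Localization.AtPrime q),
        AdicCompletion.maximalIdeal_eq_map]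
    exact ⟨nonempty_localCohomologyDegree_baseChange_equiv a ξ i u,
      localCohomologyDegree.exists_quotient_gammaTorsion_equiv hmap a ξ i u⟩
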